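/- **Setting.** Let $\mathcal A$ be a finite alphabet with $d\ge 2$ letters, $\pi=(\pi_t,\pi_b)$ irreducible combinatorial data (two bijections $\mathcal A\to\{1,\dots,d\}$ with $\pi_t^{-1}\{1,\dots,k\}\ne\pi_b^{-1}\{1,\dots,k\}$ for $1\le k<d$), $\lambda\in(\mathbb R_{>0})^{\mathcal A}$ a length vector, and $\tau\in\mathbb R^{\mathcal A}$ a suspension vector, i.e. $\sum_{\pi_t(\alpha)\le k}\tau_\alpha>0>\sum_{\pi_b(\alpha)\le k}\tau_\alpha$ for $1\le k<d$. Let $M=M(\pi,\lambda,\tau)$ be the translation surface given by Veech's zippered rectangles construction, with set of singularities $\Sigma$ and holomorphic form $\omega$. Let $\Omega_\pi$ be the antisymmetric matrix with $(\Omega_\pi)_{\alpha\beta}=1$ if $\pi_t(\alpha)<\pi_t(\beta)$ and $\pi_b(\alpha)>\pi_b(\beta)$, $-1$ if $\pi_t(\alpha)>\pi_t(\beta)$ and $\pi_b(\alpha)<\pi_b(\beta)$, and $0$ otherwise; the heights of the rectangles are $q=-\Omega_\pi\tau$, and the genus of $M$ is $g=\frac12\operatorname{rank}\Omega_\pi$.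 A horizontal connection is an orbit of the horizontal flow that starts and ends at points of $\Sigma$. *Backward algorithm.* Put $(\pi^{(0)},\tau^{(0)})=(\pi,\tau)$. For $n\le 0$, if $\sum_\alpha\tau^{(n)}_\alpha<0$ (resp. $>0$), the arrow $\gamma(n-1,n)$ is of top (resp. bottom) type; its winner $w$ is the last letter of the top (resp. bottom) row of $\pi^{(n)}$, and its loser $\ell$ is the letter that follows $w$ in the other row. Then $\pi^{(n-1)}$ is obtained by moving $\ell$ to the end of that other row, $\tau^{(n-1)}_w=\tau^{(n)}_w+\tau^{(n)}_\ell$, and the other $\tau_\alpha$ are unchanged. The matrix of the arrow is $B(n-1,n)=I+E_{\ell w}$, and $B(m,n)=B(n-1,n)\cdots B(m,m+1)$ for $m\le n\le 0$. Set $\|B\|=\sum_{\alpha,\beta}|B_{\alpha\beta}|$, and let $\|\cdot\|$ be the sup norm on $\mathbb R^{\mathcal A}$. *Dual Roth type.* $(\pi,\tau)$ is of dual Roth type if the backward algorithm never stops ($\sum_\alpha\tau_\alpha^{(n)}\neq0$ for all $n\le0$), every letter is the winner of infinitely many arrows, and: (a) with $\hat n_0=0$ and $\hat n_{k-1}$ the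 largest $n<\hat n_k$ such that every letter is the winner of at least one arrow of the path from $\pi^{(n)}$ to $\pi^{(\hat n_k)}$, for every $\varepsilon>0$ there is $C_0>0$ with $\|B(\hat n_{k-1},\hat n_k)\|\le C_0\|B(\hat n_k,0)\|^{\varepsilon}$ for all $k\le0$; (b) there are $\theta,C_1>0$ such that $\|{}^tB(n,0)v\|\le C_1\|{}^tB(n,0)\|^{1-\theta}\|v\|$ for all $n\le 0$ and all $v\in\mathbb R^{\mathcal A}$ with $\sum_\alpha q_\alpha v_\alpha=0$. *Homology.* $H_1(M,\Sigma,\mathbb R)$ has the basis $(\zeta_\alpha)_{\alpha\in\mathcal A}$ of the sides of the polygon, and $H_1(M\setminus\Sigma,\mathbb R)$ has the dual basis $(\theta^{(0)}_\alpha)_{\alpha\in\mathcal A}$ for the intersection pairing, $i(\zeta_\alpha,\theta^{(0)}_\beta)=\delta_{\alpha\beta}$; the class $\theta_\alpha^{(0)}$ follows the rectangle over $I_\alpha$ upwards and closes up along the base. For $n\le0$ let $\theta^{(n)}_\alpha$ be the analogous classes for the data at time $n$; for $n<0$ and $w,\ell$ the winner and loser of $\gamma(n,n+1)$ they satisfy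 $\theta^{(n)}_\ell=\theta^{(n+1)}_\ell-\theta^{(n+1)}_w$ and $\theta_\alpha^{(n)}=\theta_\alpha^{(n+1)}$ for $\alpha\ne\ell$. For $\varUpsilon\in H_1(M,\Sigma,\mathbb R)$ put $\chi^{(n)}_\alpha=i(\varUpsilon,\theta^{(n)}_\alpha)$. Let $\partial:H_1(M,\Sigma,\mathbb R)\to\mathbb R^\Sigma$ be the boundary operator, $\mathbb R^\Sigma_0=\{x\in\mathbb R^\Sigma:\sum_{C\in\Sigma}x_C=0\}$, and let $p_v$ be the linear form on $H_1(M\setminus\Sigma,\mathbb R)$ given by integration of $\operatorname{Im}\omega$, so that $p_v(\theta^{(0)}_\alpha)=q_\alpha$. *Negative KZ-hyperbolicity.* Let $\Gamma^u$ be the space of those $\varUpsilon\in H_1(M,\Sigma,\mathbb R)$ for which there are $\sigma,C>0$ with $\|\chi^{(n)}\|\le C\|B(n,0)\|^{-\sigma}\|\chi^{(0)}\|$ for all $n<0$. The surface $M$ is negatively KZ-hyperbolic if it has no horizontal connection, $\sum_{n<0}\|B(n,0)\|^{-t}<\infty$ for every $t>0$, $\dim\Gamma^u=g$, and for every $t>0$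 there is $C_t>0$ such that $\|\chi^{(n)}\|\le C_t\|B(n,0)\|^{t}\|\chi^{(m)}\|$ for all $\varUpsilon\in\Gamma^u$ and $n\le m\le0$. *Broken lines.* For $n<0$, the substitution of the arrow $\gamma(n,n+1)$ sends its loser $\ell$ to $\ell w$ if the arrow is of top type and to $w\ell$ if it is of bottom type, and fixes the other letters. Let $W_\alpha(0)=\alpha$, and let $W_\alpha(n)$ be the image of $W_\alpha(n+1)$ under the substitution of $\gamma(n,n+1)$. If $W_\alpha(n)=\beta_0\cdots\beta_{N-1}$, let $\mathcal W_\alpha(n)\subset H_1(M\setminus\Sigma,\mathbb R)$ be the broken line with successive vertices $\sum_{0\le i<j}\theta^{(n)}_{\beta_i}$, $0\le j\le N$. **Proposition.** Assume that $M$ is negatively KZ-hyperbolic and that $(\pi,\tau)$ is of dual Roth type. Let $\upsilon\in\mathbb R^\Sigma_0$ and let $\varUpsilon\in H_1(M,\Sigma,\mathbb R)$ be a class with $\partial\varUpsilon=\upsilon$ and $$\varlimsup_{n\to-\infty}\frac{\log(\|\chi^{(n)}\|/\|\chi^{(0)}\|)}{\log\|B(n,0)\|}\le 0$$ (in particular,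 any such class for which this upper limit equals $0$; the class $\varUpsilon=0$ is allowed). Let $\alpha\in\mathcal A$. Then for every $n\le0$ the image of $\mathcal W_\alpha(n)$ under the map $p_{\varUpsilon}(\theta)=(p_v(\theta),i(\varUpsilon,\theta))$ is the graph of a function $\Omega^{(n)}_\alpha(\varUpsilon):[0,q_\alpha]\to\mathbb R$, and these functions converge as distributions on Hölder functions as $n\to-\infty$: for every $\eta\in(0,1)$ and every $\eta$-Hölder function $\psi:[0,q_\alpha]\to\mathbb R$ with $\int_0^{q_\alpha}\psi(x)\,dx=0$, the products $\psi\,\Omega^{(n)}_\alpha(\varUpsilon)$ are integrable and the sequence $$\int_0^{q_\alpha}\psi(x)\,\Omega^{(n)}_\alpha(\varUpsilon)(x)\,dx$$ converges in $\mathbb R$ as $n\to-\infty$. -/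

import Mathlib

open Set Filter Topology
open scoped NNReal Matrix

noncomputable section

namespace RauzyVeech

/-! ### Combinatorial data and suspension data

The alphabet is a finite type `A` with at least two letters (`Nontrivial A`), `d` is its
cardinality, and positions are counted from `0` to `d - 1` (not from `1` to `d`). -/

/-- Combinatorial data `π = (π_t, π_b)`: the orders of the letters in the top and bottom rows. -/
@[ext]
structure CombData (A : Type*) [Fintype A] where
  top : A ≃ Fin (Fintype.card A)
  bot : A ≃ Fin (Fintype.card A)

section Comb

variable {A : Type*} [Fintype A]

/-- For `1 ≤ k < d`, the first `k` letters of the two rows never form the same set. -/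
def CombData.IsIrreducible (p : CombData A) : Prop :=
  ∀ k : ℕ, 1 ≤ k → k < Fintype.card A → {a | (p.top a : ℕ) < k} ≠ {a | (p.bot a : ℕ) < k}

/-- `∑ x_a` over the first `k` letters of the top row. For `x = τ` this is the height `Im U_k`
of the `k`-th vertex of the top polygonal line. -/
def CombData.topSum (p : CombData A) (x : A → ℝ) (k : ℕ) : ℝ :=
  ∑ a with (p.top a : ℕ) < k, x a

/-- `∑ x_a` over the first `k` letters of the bottom row. For `x = τ` this is `Im V_k`. -/
def CombData.botSum (p : CombData A) (x : A → ℝ) (k : ℕ) : ℝ :=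
  ∑ a with (p.bot a : ℕ) < k, x a

/-- `τ` belongs to the cone `Θ_π` of suspension vectors. -/
def CombData.IsSuspension (p : CombData A) (t : A → ℝ) : Prop :=
  ∀ k : ℕ, 1 ≤ k → k < Fintype.card A → 0 < p.topSum t k ∧ p.botSum t k < 0

/-- The antisymmetric matrix `Ω_π`. -/
def CombData.omega (p : CombData A) : Matrix A A ℝ := fun a b =>
  if p.top a < p.top b ∧ p.bot b < p.bot a then 1
  else if p.top b < p.top a ∧ p.bot a < p.bot b then -1
  else 0

/-- The genus, i.e. half the rank of `Ω_π`. -/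
def CombData.genus (p : CombData A) : ℕ := p.omega.rank / 2

/-- The heights `q = -Ω_π τ` of the rectangles. -/
def CombData.heights (p : CombData A) (t : A → ℝ) : A → ℝ := -(p.omega *ᵥ t)

/-! ### The marked points and the boundary operator -/

/-- The vertices `U_0, …, U_d` and `V_0, …, V_d` of the polygon, before any identification. -/
inductive Vertex (d : ℕ)
  | U : Fin (d + 1) → Vertex d
  | V : Fin (d + 1) → Vertex d

/-- Identifications of vertices: the two polygonal lines have the same endpoints, and the side
`ζ_a` of the top line is glued to the side `ζ_a` of the bottom line, which identifies their left
endpoints and their right endpoints. -/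
inductive VertexGlue (p : CombData A) : Vertex (Fintype.card A) → Vertex (Fintype.card A) → Prop
  | first : VertexGlue p (.U 0) (.V 0)
  | last : VertexGlue p (.U (Fin.last _)) (.V (Fin.last _))
  | left (a : A) : VertexGlue p (.U (p.top a).castSucc) (.V (p.bot a).castSucc)
  | right (a : A) : VertexGlue p (.U (p.top a).succ) (.V (p.bot a).succ)

/-- The finite set `Σ` of marked points, as the set of classes of vertices of the polygon
(equivalently, of cycles of the permutation that turns around the vertices). -/
def CombData.Marked (p : CombData A) : Type := Quot (VertexGlue p)

/-- The relative homology group `H_1(M, Σ, ℝ)`. The surface `M` has a cell decomposition with one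
2-cell (the polygon), one 1-cell `ζ_a` for each letter, and `Σ` as the set of 0-cells. The side
`ζ_a` appears twice, with opposite orientations, in the boundary of the 2-cell, which therefore
vanishes, and there are no relative 0-cells; so `H_1(M, Σ, ℝ)` is the space of relative cellular
1-chains `∑ χ_a ζ_a`. A class is represented by its coordinates `χ = χ^{(0)}` in this basis. -/
abbrev RelHomology (A : Type*) : Type _ := A → ℝ

/-- The homology `H_1(M ∖ Σ, ℝ)` of the punctured surface. The punctured surface retracts onto the
graph dual to the cell decomposition above: one vertex, and one loop `θ_a` crossing once the side
`ζ_a`, for each letter. A class is represented by its coordinates in the basis `θ_a = θ_a^{(0)}`. -/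
abbrev PuncturedHomology (A : Type*) : Type _ := A → ℝ

/-- The intersection pairing between `H_1(M, Σ, ℝ)` and `H_1(M ∖ Σ, ℝ)`: the bases
`(ζ_a)` and `(θ_a)` are dual to each other. -/
def intersection (c : RelHomology A) (t : PuncturedHomology A) : ℝ := ∑ a, c a * t a

open Classical in
/-- The boundary operator `∂ : H_1(M, Σ, ℝ) → H_0(Σ, ℝ) = ℝ^Σ`: the side `ζ_a` of the top
line goes from `U_i` to `U_{i+1}` where `i` is the position of `a` in the top row. -/
def CombData.boundary (p : CombData A) (c : RelHomology A) : p.Marked → ℝ := fun C =>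
  ∑ a, c a * ((if Quot.mk _ (.U (p.top a).succ) = C then 1 else 0)
    - (if Quot.mk _ (.U (p.top a).castSucc) = C then 1 else 0))

end Comb

/-! ### The backward Rauzy–Veech algorithm -/

/-- The permutation of positions which moves position `k + 1` to the last place, shifts the
positions `> k + 1` by one to the left and fixes the positions `≤ k` (the identity if `k` is
already the last position). -/
def moveLast {d : ℕ} (k : Fin d) : Equiv.Perm (Fin d) where
  toFun j := if j.1 ≤ k.1 then j else
    if j.1 = k.1 + 1 then ⟨d - 1, by have := k.2; omega⟩ else ⟨j.1 - 1, by omega⟩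
  invFun j := if h : j.1 ≤ k.1 then j else
    if h' : j.1 = d - 1 then ⟨k.1 + 1, by omega⟩ else ⟨j.1 + 1, by omega⟩
  left_inv j := by
    ext
    have hj := j.2
    have hk := k.2
    by_cases h1 : j.1 ≤ k.1
    · simp [h1]
    · by_cases h2 : j.1 = k.1 + 1
      · have h3 : ¬ d - 1 ≤ k.1 := by omega
        simp [h2, h3]
      · have h3 : ¬ j.1 - 1 ≤ k.1 := by omega
        have h4 : ¬ j.1 - 1 = d - 1 := by omega
        simp [h1, h2, h3, h4]
        omega
  right_inv j := by
    ext
    have hj := j.2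
    have hk := k.2
    by_cases h1 : j.1 ≤ k.1
    · simp [h1]
    · by_cases h2 : j.1 = d - 1
      · have h3 : ¬ k.1 + 1 ≤ k.1 := by omega
        have h4 : ¬ d - 1 ≤ k.1 := by omega
        simp [h2, h4]
      · have h3 : ¬ j.1 + 1 ≤ k.1 := by omega
        have h4 : ¬ j.1 = k.1 := by omega
        simp [h1, h2, h3, h4]

section Backward

variable {A : Type*} [Fintype A] [Nontrivial A]

/-- The last letter of a row. -/
def lastLetter (r : A ≃ Fin (Fintype.card A)) : A :=
  r.symm ⟨Fintype.card A - 1, Nat.sub_lt Fintype.card_pos Nat.one_pos⟩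

/-- The letter which follows `a` in a row (`a` itself if `a` is the last letter). -/
def nextLetter (r : A ≃ Fin (Fintype.card A)) (a : A) : A :=
  if h : (r a : ℕ) + 1 < Fintype.card A then r.symm ⟨(r a : ℕ) + 1, h⟩ else a

/-- A pair `(π, τ)`. -/
abbrev PiTau (A : Type*) [Fintype A] : Type _ := CombData A × (A → ℝ)

/-- The arrow which ends at `π` has top type when `∑ τ_a < 0`, and bottom type
when `∑ τ_a > 0` (the case `∑ τ_a = 0`, where the backward algorithm stops, is
excluded wherever the arrow is used). -/
def IsTopType (s : PiTau A) : Prop := ∑ a, s.2 a < 0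

open Classical in
/-- The winner of the arrow which ends at `π`. -/
def winner (s : PiTau A) : A :=
  if IsTopType s then lastLetter s.1.top else lastLetter s.1.bot

open Classical in
/-- The loser of the arrow which ends at `π`: it follows the winner in the other row. -/
def loser (s : PiTau A) : A :=
  if IsTopType s then nextLetter s.1.bot (winner s) else nextLetter s.1.top (winner s)

variable [DecidableEq A]

open Classical in
/-- One step of the backward algorithm, from `(π^{(n)}, τ^{(n)})` to `(π^{(n-1)}, τ^{(n-1)})`. -/
def backStep (s : PiTau A) : PiTau A :=
  (if IsTopType s then ⟨s.1.top, s.1.bot.trans (moveLast (s.1.bot (winner s)))⟩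
    else ⟨s.1.top.trans (moveLast (s.1.top (winner s))), s.1.bot⟩,
  Function.update s.2 (winner s) (s.2 (winner s) + s.2 (loser s)))

/-- `(π^{(-n)}, τ^{(-n)})`, for `n ≥ 0`. -/
def backIter (s : PiTau A) (n : ℕ) : PiTau A := backStep^[n] s

/-- The matrix `B_γ = 1 + E_{loser, winner}` of the arrow `γ` which ends at `π`. -/
def arrowMatrix (s : PiTau A) : Matrix A A ℝ := 1 + Matrix.single (loser s) (winner s) 1

/-- The Kontsevich–Zorich matrix `B(-n, 0)` of the path that consists of the last `n` arrows. -/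
def kz (s : PiTau A) : ℕ → Matrix A A ℝ
  | 0 => 1
  | n + 1 => kz s n * arrowMatrix (backIter s n)

/-- The matrix `B(-m, -n)`, for `n ≤ m`. -/
def kzBetween (s : PiTau A) (m n : ℕ) : Matrix A A ℝ := kz (backIter s n) (m - n)

/-- The norm of a matrix is the sum of the absolute values of its entries; vectors of `ℝ^A` have
the sup norm. -/
def matNorm (B : Matrix A A ℝ) : ℝ := ∑ a, ∑ b, |B a b|

/-- The backward algorithm never stops, so that `(π, τ)` has a backward rotation number. -/
def HasBackwardRotationNumber (s : PiTau A) : Prop := ∀ n, ∑ a, (backIter s n).2 a ≠ 0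

/-- The backward rotation number is `∞`-complete: it is a concatenation of infinitely many finite
paths in which every letter wins, i.e. every letter wins infinitely often. -/
def IsInfinitelyComplete (s : PiTau A) : Prop :=
  ∀ a : A, ∀ N : ℕ, ∃ i, N ≤ i ∧ winner (backIter s i) = a

/-- The accelerated times: `accTime s k` is `-n̂_{-k}`. Given `n̂`, the next time is the largest
integer `n < n̂` such that every letter is the winner of an arrow of the path `γ(n, n̂)`. -/
def accTime (s : PiTau A) : ℕ → ℕ
  | 0 => 0
  | k + 1 => sInf {m | accTime s k < m ∧
      ∀ a : A, ∃ i, accTime s k ≤ i ∧ i < m ∧ winner (backIter s i) = a}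

/-- `(π, τ)` is of (weak) dual Roth type. In the spectral gap condition, the hyperplane is
the space of the functions constant on each interval `L_a = (0, q_a)`, with zero mean on the
disjoint union of these intervals. -/
structure IsDualRothType (s : PiTau A) : Prop where
  rotation : HasBackwardRotationNumber s
  complete : IsInfinitelyComplete s
  growth : ∀ ε : ℝ, 0 < ε → ∃ C₀ : ℝ, 0 < C₀ ∧ ∀ k : ℕ,
    matNorm (kzBetween s (accTime s (k + 1)) (accTime s k)) ≤ C₀ * matNorm (kz s (accTime s k)) ^ ε
  gap : ∃ θ : ℝ, 0 < θ ∧ ∃ C₁ : ℝ, 0 < C₁ ∧ ∀ n : ℕ, ∀ v : A → ℝ,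
    ∑ a, s.1.heights s.2 a * v a = 0 →
      ‖(kz s n)ᵀ *ᵥ v‖ ≤ C₁ * matNorm (kz s n)ᵀ ^ (1 - θ) * ‖v‖

/-! ### Homology bases attached to the algorithm -/

/-- The class `θ_a^{(-n)}` in `H_1(M ∖ Σ, ℝ)`. For the arrow from `π^{(m)}` to `π^{(m+1)}` one has
`θ_ℓ^{(m+1)} = θ_ℓ^{(m)} + θ_w^{(m)}` for the loser `ℓ` and the winner `w`, the other classes do
not change. -/
def theta (s : PiTau A) : ℕ → A → PuncturedHomology A
  | 0 => fun a => Pi.single a 1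
  | n + 1 => Function.update (theta s n) (loser (backIter s n))
      (theta s n (loser (backIter s n)) - theta s n (winner (backIter s n)))

/-- The coordinates `χ_a^{(-n)} = i(ϒ, θ_a^{(-n)})` of `ϒ = ∑ χ_a^{(-n)} ζ_a^{(-n)}`. -/
def chi (s : PiTau A) (c : RelHomology A) (n : ℕ) : A → ℝ := fun a =>
  intersection c (theta s n a)

theorem chi_zero (s : PiTau A) (c : RelHomology A) : chi s c 0 = c := by
  ext a
  simp [chi, theta, intersection, Pi.single_apply]

theorem chi_add (s : PiTau A) (c c' : RelHomology A) (n : ℕ) :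
    chi s (c + c') n = chi s c n + chi s c' n := by
  ext a
  simp [chi, intersection, add_mul, Finset.sum_add_distrib]

theorem chi_smul (s : PiTau A) (r : ℝ) (c : RelHomology A) (n : ℕ) :
    chi s (r • c) n = r • chi s c n := by
  ext a
  simp [chi, intersection, Finset.mul_sum, mul_assoc]

theorem one_le_kz (s : PiTau A) (n : ℕ) (a b : A) : (1 : Matrix A A ℝ) a b ≤ kz s n a b := by
  induction n generalizing a b with
  | zero => exact le_rfl
  | succ n ih =>
    have h : ∀ a b, 0 ≤ kz s n a b := fun a b => le_trans (by
      rw [Matrix.one_apply]; split_ifs <;> norm_num) (ih a b)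
    rw [kz, arrowMatrix, mul_add, mul_one, Matrix.add_apply, Matrix.mul_apply]
    have : 0 ≤ ∑ j, kz s n a j *
        Matrix.single (loser (backIter s n)) (winner (backIter s n)) (1 : ℝ) j b :=
      Finset.sum_nonneg fun j _ => mul_nonneg (h a j) (by
        rw [Matrix.single_apply]; split_ifs <;> norm_num)
    linarith [ih a b]

theorem one_le_matNorm_kz (s : PiTau A) (n : ℕ) : 1 ≤ matNorm (kz s n) := by
  obtain ⟨a⟩ : Nonempty A := inferInstance
  have h1 : |kz s n a a| ≤ ∑ b, |kz s n a b| :=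
    Finset.single_le_sum (f := fun b => |kz s n a b|) (fun _ _ => abs_nonneg _)
      (Finset.mem_univ a)
  have h2 : ∑ b, |kz s n a b| ≤ matNorm (kz s n) :=
    Finset.single_le_sum (f := fun a => ∑ b, |kz s n a b|)
      (fun _ _ => Finset.sum_nonneg fun _ _ => abs_nonneg _) (Finset.mem_univ a)
  have h3 := one_le_kz s n a a
  rw [Matrix.one_apply_eq] at h3
  linarith [le_abs_self (kz s n a a)]

/-- The unstable subspace `Γ^u` of `H_1(M, Σ, ℝ)`. -/
def unstable (s : PiTau A) : Submodule ℝ (RelHomology A) where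
  carrier := {c | ∃ σ : ℝ, 0 < σ ∧ ∃ C : ℝ, 0 < C ∧ ∀ n : ℕ, 0 < n →
    ‖chi s c n‖ ≤ C * matNorm (kz s n) ^ (-σ) * ‖chi s c 0‖}
  zero_mem' := ⟨1, one_pos, 1, one_pos, fun n _ => by
    have h : ∀ m, chi s 0 m = 0 := fun m => by
      simpa using chi_smul s 0 0 m
    simp [h]⟩
  smul_mem' r c := by
    rintro ⟨σ, hσ, C, hC, h⟩
    refine ⟨σ, hσ, C, hC, fun n hn => ?_⟩
    rw [chi_smul, chi_smul, norm_smul, norm_smul]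
    have := mul_le_mul_of_nonneg_left (h n hn) (norm_nonneg r)
    linarith
  add_mem' {c c'} := by
    rintro ⟨σ, hσ, C, hC, h⟩ ⟨σ', hσ', C', hC', h'⟩
    by_cases h0 : c + c' = 0
    · refine ⟨1, one_pos, 1, one_pos, fun n _ => ?_⟩
      have h : ∀ m, chi s 0 m = 0 := fun m => by
        simpa using chi_smul s 0 0 m
      simp [h0, h]
    · have hpos : 0 < ‖c + c'‖ := norm_pos_iff.2 h0
      refine ⟨min σ σ', lt_min hσ hσ', (C * ‖c‖ + C' * ‖c'‖ + 1) / ‖c + c'‖, by positivity,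
        fun n hn => ?_⟩
      have e1 := h n hn
      have e2 := h' n hn
      rw [chi_zero] at e1 e2 ⊢
      rw [chi_add]
      have hB := one_le_matNorm_kz s n
      have p1 : matNorm (kz s n) ^ (-σ) ≤ matNorm (kz s n) ^ (-min σ σ') :=
        Real.rpow_le_rpow_of_exponent_le hB (neg_le_neg (min_le_left _ _))
      have p2 : matNorm (kz s n) ^ (-σ') ≤ matNorm (kz s n) ^ (-min σ σ') :=
        Real.rpow_le_rpow_of_exponent_le hB (neg_le_neg (min_le_right _ _))
      have p3 : 0 ≤ matNorm (kz s n) ^ (-min σ σ') := Real.rpow_nonneg (by linarith) _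
      calc ‖chi s c n + chi s c' n‖ ≤ ‖chi s c n‖ + ‖chi s c' n‖ := norm_add_le _ _
        _ ≤ C * matNorm (kz s n) ^ (-min σ σ') * ‖c‖
            + C' * matNorm (kz s n) ^ (-min σ σ') * ‖c'‖ := by
          refine add_le_add (e1.trans ?_) (e2.trans ?_) <;> gcongr
        _ ≤ (C * ‖c‖ + C' * ‖c'‖ + 1) * matNorm (kz s n) ^ (-min σ σ') := by nlinarith
        _ = (C * ‖c‖ + C' * ‖c'‖ + 1) / ‖c + c'‖ * matNorm (kz s n) ^ (-min σ σ')
            * ‖c + c'‖ := by field_simp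

/-! ### Broken lines and the functions `Ω_a^{(n)}(ϒ)` -/

open Classical in
/-- The substitution `ς_γ` of the arrow `γ` which ends at `π`, on letters. -/
def substLetter (s : PiTau A) (a : A) : List A :=
  if a = loser s then
    if IsTopType s then [loser s, winner s] else [winner s, loser s]
  else [a]

/-- The word `W_a(-n)`. -/
def word (s : PiTau A) (a : A) : ℕ → List A
  | 0 => [a]
  | n + 1 => (word s a n).flatMap (substLetter (backIter s n))

/-- The `j`-th vertex of the broken line attached to the word `W_a(-n)`. -/
def lineVertex (s : PiTau A) (a : A) (n j : ℕ) : PuncturedHomology A :=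
  (((word s a n).take j).map (theta s n)).sum

/-- The broken line attached to the word `W_a(-n)`. -/
def brokenLine (s : PiTau A) (a : A) (n : ℕ) : Set (PuncturedHomology A) :=
  ⋃ j ∈ Finset.range (word s a n).length,
    segment ℝ (lineVertex s a n j) (lineVertex s a n (j + 1))

/-- The linear form `p_v` on `H_1(M ∖ Σ, ℝ)` given by integration of `Im ω`:
its value on `θ_a` is the height `q_a`. -/
def pVert (s : PiTau A) (t : PuncturedHomology A) : ℝ := ∑ a, s.1.heights s.2 a * t a

/-- The map `p_ϒ = (p_v, i(ϒ, ·))`. -/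
def pClass (s : PiTau A) (c : RelHomology A) (t : PuncturedHomology A) : ℝ × ℝ :=
  (pVert s t, intersection c t)

open Classical in
/-- The function `Ω_a^{(-n)}(ϒ)` whose graph is the image of the broken line by `p_ϒ` (extended
by `0` outside of the projection of this image to the first axis). -/
def limitShape (s : PiTau A) (c : RelHomology A) (a : A) (n : ℕ) (x : ℝ) : ℝ :=
  if h : ∃ y, (x, y) ∈ pClass s c '' brokenLine s a n then h.choose else 0

end Backward

/-! ### The translation surface and its horizontal connections -/

/-- Data `(π, λ, τ)` defining a translation surface by the zippered rectangles construction. -/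
structure ZipData (A : Type*) [Fintype A] where
  comb : CombData A
  irreducible : comb.IsIrreducible
  lam : A → ℝ
  lam_pos : ∀ a, 0 < lam a
  tau : A → ℝ
  suspension : comb.IsSuspension tau

namespace ZipData

variable {A : Type*} [Fintype A] (M : ZipData A)

/-- The pair `(π, τ)`. -/
def piTau : PiTau A := (M.comb, M.tau)

/-- The heights `q_a = q_a^{(0)}` of the rectangles. -/
def q : A → ℝ := M.comb.heights M.tau

/-- The left endpoint of the top interval `I_a^t`. -/
def xl (a : A) : ℝ := M.comb.topSum M.lam (M.comb.top a)

/-- The right endpoint of the top interval `I_a^t`. -/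
def xr (a : A) : ℝ := M.xl a + M.lam a

/-- The left endpoint of the bottom interval `I_a^b`. -/
def xlBot (a : A) : ℝ := M.comb.botSum M.lam (M.comb.bot a)

/-- The disjoint union of the closed rectangles `I_a × [0, q_a]`. -/
def Rectangles : Type _ :=
  {p : A × ℝ × ℝ // p.2.1 ∈ Icc (M.xl p.1) (M.xr p.1) ∧ p.2.2 ∈ Icc 0 (M.q p.1)}

/-- The gluings of the zippered rectangles construction, in coordinates `(letter, x, y)`.
The singularity `U_k` is at height `topSum τ k` above `u_k^t`, the singularity `V_k` is at depth
`-botSum τ k` below `u_k^b`. -/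
inductive Glue : A × ℝ × ℝ → A × ℝ × ℝ → Prop
  /-- The top of the rectangle of `a` is glued to the bottom interval `I_a^b` of the base. -/
  | base (a b : A) (x : ℝ) :
      Glue (a, x, M.q a) (b, x - M.xl a + M.xlBot a, 0)
  /-- Rectangles whose bases are adjacent are glued below the singularity `U_k`. -/
  | lower (a b : A) (y : ℝ) (hab : (M.comb.top b : ℕ) = M.comb.top a + 1)
      (hy : y ≤ M.comb.topSum M.tau (M.comb.top b)) :
      Glue (a, M.xr a, y) (b, M.xl b, y)
  /-- Rectangles whose tops are adjacent are glued above the singularity `V_k`; here `z` is the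
  depth below the tops. -/
  | upper (a b : A) (z : ℝ) (hab : (M.comb.bot b : ℕ) = M.comb.bot a + 1)
      (hz : z ≤ -M.comb.botSum M.tau (M.comb.bot b)) :
      Glue (a, M.xr a, M.q a - z) (b, M.xl b, M.q b - z)
  /-- If `∑ τ > 0`, the vertical segment from the right endpoint of the base up to `U_d` lies on
  the right side of the rectangle of the last top letter `a`; above the top right corner of the
  rectangle of the last bottom letter `b`, it bounds the rectangle of the letter `c` which follows
  `b` in the top row. -/
  | endUp (a b c : A) (y : ℝ) (ha : (M.comb.top a : ℕ) + 1 = Fintype.card A)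
      (hb : (M.comb.bot b : ℕ) + 1 = Fintype.card A)
      (hc : (M.comb.top c : ℕ) = M.comb.top b + 1) (hy : y ≤ ∑ e, M.tau e) :
      Glue (a, M.xr a, y) (c, M.xl c, M.q b + y)
  /-- If `∑ τ < 0`, the vertical segment from the right endpoint of the base down to `V_d` lies
  on the right side of the rectangle of the last bottom letter `a`; below the bottom right corner
  of the rectangle of the last top letter `b`, it bounds the rectangle of the letter `c` which
  follows `b` in the bottom row. -/
  | endDown (a b c : A) (z : ℝ) (ha : (M.comb.bot a : ℕ) + 1 = Fintype.card A)
      (hb : (M.comb.top b : ℕ) + 1 = Fintype.card A)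
      (hc : (M.comb.bot c : ℕ) = M.comb.bot b + 1) (hz : z ≤ -∑ e, M.tau e) :
      Glue (a, M.xr a, M.q a - z) (c, M.xl c, M.q c - (M.q b + z))

/-- The translation surface `M(π, λ, τ)`, as a set of points. -/
def Surface : Type _ := Quot fun p p' : M.Rectangles => M.Glue p.1 p'.1

/-- The left endpoint of the horizontal chord at height `y` of the rectangle of `a`. -/
def chordLeft (a : A) (y : Icc (0 : ℝ) (M.q a)) : M.Surface :=
  Quot.mk _ ⟨(a, M.xl a, y), ⟨le_rfl, by simpa [xr] using (M.lam_pos a).le⟩, y.2⟩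

/-- The right endpoint of the horizontal chord at height `y` of the rectangle of `a`. -/
def chordRight (a : A) (y : Icc (0 : ℝ) (M.q a)) : M.Surface :=
  Quot.mk _ ⟨(a, M.xr a, y), ⟨by simpa [xr] using (M.lam_pos a).le, le_rfl⟩, y.2⟩

/-- The set of singularities, a subset of the surface: for `k < d`, the point `U_k` lies
on the left side of the rectangle of the letter in position `k` of the top row, at height
`topSum τ k` (and `U_d` is identified with one of these). -/
def sing : Set M.Surface :=
  {P | ∃ (a : A) (y : Icc (0 : ℝ) (M.q a)),
    (y : ℝ) = M.comb.topSum M.tau (M.comb.top a) ∧ P = M.chordLeft a y}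

/-- `M` has a horizontal connection: an orbit of the horizontal flow which starts and ends
at singularities. Such an orbit is a finite concatenation of horizontal chords of rectangles. -/
def HasHorizontalConnection : Prop :=
  ∃ (m : ℕ) (c : ℕ → (a : A) × Icc (0 : ℝ) (M.q a)),
    M.chordLeft (c 0).1 (c 0).2 ∈ M.sing ∧
    (∀ i < m, M.chordRight (c i).1 (c i).2 = M.chordLeft (c (i + 1)).1 (c (i + 1)).2 ∧
      M.chordRight (c i).1 (c i).2 ∉ M.sing) ∧
    M.chordRight (c m).1 (c m).2 ∈ M.sing

variable [Nontrivial A] [DecidableEq A]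

/-- The surface is negatively KZ-hyperbolic. -/
structure IsNegKZHyperbolic : Prop where
  no_connection : ¬ M.HasHorizontalConnection
  summable : ∀ t : ℝ, 0 < t → Summable fun n : ℕ => matNorm (kz M.piTau n) ^ (-t)
  finrank_unstable : Module.finrank ℝ (unstable M.piTau) = M.comb.genus
  coherence : ∀ t : ℝ, 0 < t → ∃ C : ℝ, 0 < C ∧ ∀ c ∈ unstable M.piTau, ∀ m n : ℕ, m ≤ n →
    ‖chi M.piTau c n‖ ≤ C * matNorm (kz M.piTau n) ^ t * ‖chi M.piTau c m‖

/-- The class `ϒ` grows at most subpolynomially in the past: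
`limsup_{n → -∞} log (‖χ^{(n)}‖ / ‖χ^{(0)}‖) / log ‖B(n, 0)‖ ≤ 0`. (The limsup is taken in the
extended reals. When `∂ϒ ≠ 0` the norms `‖χ^{(n)}‖` are bounded away from zero, so that the limsup
is also nonnegative; a negative value is possible only when `∂ϒ = 0`.) -/
def IsSubpolynomial (c : RelHomology A) : Prop :=
  limsup (fun n : ℕ => ((Real.log (‖chi M.piTau c n‖ / ‖chi M.piTau c 0‖) /
    Real.log (matNorm (kz M.piTau n)) : ℝ) : EReal)) atTop ≤ 0

end ZipData

end RauzyVeech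

end

open RauzyVeech

noncomputable section

/-! Write N for the norm of B(-n,0). Going from time -n to time -n-1 replaces each occurrence of the
loser in the word by two letters with the same total displacement. Hence two consecutive limit
shapes agree at all block endpoints and differ only above the loser blocks, where the difference is
always a translate of one fixed bump. Subpolynomial growth makes this bump O(N^ε), which is not
small: the convergence comes from cancellation against a test function ψ of mean zero.

To see the cancellation, choose an intermediate time -m whose matrix has norm about N^κ, with κ
small, and replace ψ by its averages over the blocks at time -m (`IsBlockSum.abs_integral_sub_le`).
These blocks are short, so by Hölder continuity the replacement costs a negative power of N which
beats N^ε. The averages, added up letter by letter, form a vector v, orthogonal to the heights at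
time -m because ψ has mean zero. The occurrences of the loser ℓ inside the blocks are counted by
B(-n,-m), so what remains is the ℓ-coordinate of ᵗB(-n,-m)v times the integral of the bump.

The spectral gap, transported from time 0 to time -m at a cost polynomial in N^κ
(`NeverStops.norm_kz_transpose_mulVec_le`), bounds the first factor by N^(1-θ+O(κ)). The bump has
height O(N^ε) and a base of length O(N^(-1+ε)). For small κ and ε the product is O(N^(-ε)), which is
summable over n, so the integrals form a Cauchy sequence.

The bound N^(-1+ε) on the rectangle heights is `IsDualRothType.heightsAt_le`. A concatenation of 2d
complete paths has a positive matrix, so every height after it is at most every height before it;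
the growth condition limits what is lost over these 2d paths. -/

namespace RauzyVeech

/-! ### Partial sums along a row, and their behaviour when a letter moves to the end. -/

section RowSums

variable {A : Type*} [Fintype A]

/-- The sum of `x` over the first `k` letters of a row. -/
def rowSum (r : A ≃ Fin (Fintype.card A)) (x : A → ℝ) (k : ℕ) : ℝ :=
  ∑ a, if (r a : ℕ) < k then x a else 0

theorem CombData.topSum_eq_rowSum (p : CombData A) (x : A → ℝ) (k : ℕ) :
    p.topSum x k = rowSum p.top x k := by
  simp [topSum, rowSum, Finset.sum_filter]

theorem CombData.botSum_eq_rowSum (p : CombData A) (x : A → ℝ) (k : ℕ) :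
    p.botSum x k = rowSum p.bot x k := by
  simp [botSum, rowSum, Finset.sum_filter]

theorem rowSum_card (r : A ≃ Fin (Fintype.card A)) (x : A → ℝ) :
    rowSum r x (Fintype.card A) = ∑ a, x a := by
  simp [rowSum]

theorem rowSum_zero (r : A ≃ Fin (Fintype.card A)) (x : A → ℝ) : rowSum r x 0 = 0 := by
  simp [rowSum]

theorem rowSum_succ (r : A ≃ Fin (Fintype.card A)) (x : A → ℝ) (a : A) :
    rowSum r x (r a + 1) = rowSum r x (r a) + x a := by
  classical
  have h : ∀ b, (if (r b : ℕ) < r a + 1 then x b else 0) =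
      (if (r b : ℕ) < r a then x b else 0) + if b = a then x a else 0 := by
    intro b
    by_cases hb : b = a
    · subst hb; simp
    · have : (r b : ℕ) ≠ r a := fun h => hb (r.injective (Fin.ext h))
      have e : (r b : ℕ) < r a + 1 ↔ (r b : ℕ) < r a := by omega
      simp [hb, e]
  unfold rowSum
  rw [Finset.sum_congr rfl fun b _ => h b, Finset.sum_add_distrib]
  simp

/-- The entry (a, b) of -Ω is the indicator of "b precedes a on top" minus the indicator of "b
precedes a at the bottom". -/
theorem CombData.heights_eq (p : CombData A) (t : A → ℝ) (a : A) :
    p.heights t a = rowSum p.top t (p.top a) - rowSum p.bot t (p.bot a) := by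
  simp only [heights, Pi.neg_apply, Matrix.mulVec, dotProduct, rowSum]
  rw [← Finset.sum_neg_distrib, ← Finset.sum_sub_distrib]
  refine Finset.sum_congr rfl fun b _ => ?_
  by_cases hab : a = b
  · subst hab; simp [omega]
  · have h1 : (p.top a : ℕ) ≠ p.top b := fun h => hab (p.top.injective (Fin.ext h))
    have h2 : (p.bot a : ℕ) ≠ p.bot b := fun h => hab (p.bot.injective (Fin.ext h))
    simp only [omega, Fin.lt_def]
    rcases lt_or_gt_of_ne h1 with h1 | h1 <;> rcases lt_or_gt_of_ne h2 with h2 | h2 <;>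
      simp [h1, h2, h1.not_gt, h2.not_gt]

theorem apply_nextLetter {r : A ≃ Fin (Fintype.card A)} {a : A}
    (h : (r a : ℕ) + 1 < Fintype.card A) : (r (nextLetter r a) : ℕ) = r a + 1 := by
  simp [nextLetter, h]

theorem ne_nextLetter {r : A ≃ Fin (Fintype.card A)} {a : A}
    (h : (r a : ℕ) + 1 < Fintype.card A) : a ≠ nextLetter r a := fun hh => by
  have := congrArg (fun c => (r c : ℕ)) hh
  simp only [apply_nextLetter h] at this
  omega

theorem moveLast_apply {d : ℕ} (k j : Fin d) : (moveLast k j : ℕ) =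
    if j.1 ≤ k.1 then j.1 else if j.1 = k.1 + 1 then d - 1 else j.1 - 1 := by
  simp only [moveLast, Equiv.coe_fn_mk]
  split_ifs <;> rfl

/-- Past the winner `a`, the first `k` letters of the new row omit the loser, but the updated value
at `a` carries it: the sum is the old one with one more letter. The bound `k < d` keeps the loser,
now in last position, from being counted twice. -/
theorem rowSum_trans_moveLast [DecidableEq A] {r : A ≃ Fin (Fintype.card A)} {a : A}
    (h : (r a : ℕ) + 1 < Fintype.card A) (x : A → ℝ) {k : ℕ} (hk : k < Fintype.card A) :
    rowSum (r.trans (moveLast (r a))) (Function.update x a (x a + x (nextLetter r a))) k =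
      if k ≤ r a then rowSum r x k else rowSum r x (k + 1) := by
  have hn := apply_nextLetter h
  split_ifs with hka
  · refine Finset.sum_congr rfl fun b _ => ?_
    by_cases hb : b = a
    · subst hb
      simp [moveLast_apply, hka.not_gt]
    · simp only [Equiv.trans_apply, moveLast_apply, Function.update_of_ne hb]
      refine if_congr ?_ rfl rfl
      split_ifs <;> omega
  · have e : ∀ b, (if ((r.trans (moveLast (r a))) b : ℕ) < k then
        Function.update x a (x a + x (nextLetter r a)) b else 0) =
        (if (r b : ℕ) < k + 1 then x b else 0) - (if b = nextLetter r a then x b else 0)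
          + (if b = a then x (nextLetter r a) else 0) := by
      intro b
      simp only [Equiv.trans_apply, moveLast_apply]
      by_cases hb : b = a
      · subst hb
        have h1 : b ≠ nextLetter r b := fun hh => by
          have := congrArg (fun c => (r c : ℕ)) hh
          omega
        have h2 : (r b : ℕ) < k := by omega
        have h3 : (r b : ℕ) < k + 1 := by omega
        simp [h1, h2, h3]
      · by_cases hb' : b = nextLetter r a
        · subst hb'
          have h1 : ¬ (r (nextLetter r a) : ℕ) ≤ r a := by omega
          have h2 : (r (nextLetter r a) : ℕ) < k + 1 := by omega
          have h3 : ¬ Fintype.card A - 1 < k := by omega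
          simp only [if_neg h1, if_pos hn, if_neg h3, if_pos h2, if_neg hb, if_true]
          ring
        · have h1 : (r b : ℕ) ≠ r a + 1 := fun hh =>
            hb' (r.injective (Fin.ext (hh.trans hn.symm)))
          simp only [Function.update_of_ne hb, if_neg hb, if_neg hb', if_neg h1, sub_zero, add_zero]
          refine if_congr ?_ rfl rfl
          split_ifs <;> omega
    simp only [rowSum]
    rw [Finset.sum_congr rfl fun b _ => e b, Finset.sum_add_distrib, Finset.sum_sub_distrib]
    simp

/-- Only the loser sees a change: it is now preceded by all other letters, and the updated winner
already contains its value, whence the total sum. -/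
theorem rowSum_trans_moveLast_apply [DecidableEq A] {r : A ≃ Fin (Fintype.card A)} {a : A}
    (h : (r a : ℕ) + 1 < Fintype.card A) (x : A → ℝ) (b : A) :
    rowSum (r.trans (moveLast (r a))) (Function.update x a (x a + x (nextLetter r a)))
        ((r.trans (moveLast (r a))) b) =
      if b = nextLetter r a then ∑ c, x c else rowSum r x (r b) := by
  have hn := apply_nextLetter h
  rw [rowSum_trans_moveLast h x (Fin.is_lt _)]
  simp only [Equiv.trans_apply, moveLast_apply]
  by_cases hb : b = nextLetter r a
  · subst hb
    have h1 : ¬ (r (nextLetter r a) : ℕ) ≤ r a := by omega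
    have h2 : ¬ Fintype.card A - 1 ≤ (r a : ℕ) := by omega
    simp only [if_neg h1, if_pos hn, if_neg h2, if_true]
    rw [Nat.sub_add_cancel (by omega), rowSum_card]
  · have h1 : (r b : ℕ) ≠ r a + 1 := fun hh => hb (r.injective (Fin.ext (hh.trans hn.symm)))
    simp only [if_neg hb, if_neg h1]
    by_cases h2 : (r b : ℕ) ≤ r a
    · simp [h2]
    · have h3 : ¬ (r b : ℕ) - 1 ≤ r a := by omega
      simp only [if_neg h2, if_neg h3]
      rw [Nat.sub_add_cancel (by omega)]

variable [Nontrivial A]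

theorem apply_lastLetter (r : A ≃ Fin (Fintype.card A)) :
    (r (lastLetter r) : ℕ) = Fintype.card A - 1 := by
  simp [lastLetter]

theorem rowSum_card_sub_one (r : A ≃ Fin (Fintype.card A)) (x : A → ℝ) :
    rowSum r x (Fintype.card A - 1) = ∑ a, x a - x (lastLetter r) := by
  have h := rowSum_succ r x (lastLetter r)
  have := Fintype.one_lt_card (α := A)
  rw [apply_lastLetter, Nat.sub_add_cancel (by omega), rowSum_card] at h
  linarith

theorem lastLetter_trans_moveLast {r : A ≃ Fin (Fintype.card A)} {a : A}
    (h : (r a : ℕ) + 1 < Fintype.card A) :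
    lastLetter (r.trans (moveLast (r a))) = nextLetter r a := by
  unfold lastLetter
  rw [Equiv.symm_apply_eq]
  ext
  simp [moveLast_apply, apply_nextLetter h]

theorem rowSum_update_lastLetter [DecidableEq A] (r : A ≃ Fin (Fintype.card A)) (x : A → ℝ)
    (y : ℝ) {k : ℕ} (hk : k < Fintype.card A) :
    rowSum r (Function.update x (lastLetter r) y) k = rowSum r x k := by
  refine Finset.sum_congr rfl fun a _ => ?_
  by_cases ha : a = lastLetter r
  · subst ha
    have : ¬ (Fintype.card A - 1 < k) := by omega
    simp [apply_lastLetter, this]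
  · simp [ha]

end RowSums

/-! ### One backward step: suspension data, winners and heights. -/

section Dynamics

variable {A : Type*} [Fintype A] [Nontrivial A]

/-- A letter cannot come first in both rows, since the sum over the first letter would be positive
on top and negative at the bottom; so at least one of the two partial sums is nonzero, with the
right sign. -/
theorem CombData.IsSuspension.heights_pos {p : CombData A} {t : A → ℝ} (h : p.IsSuspension t)
    (a : A) : 0 < p.heights t a := by
  have h' : ∀ k : ℕ, 1 ≤ k → k < Fintype.card A → 0 < rowSum p.top t k ∧ rowSum p.bot t k < 0 :=
    fun k h1 h2 => by simpa [topSum_eq_rowSum, botSum_eq_rowSum] using h k h1 h2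
  rw [heights_eq]
  rcases Nat.eq_zero_or_pos (p.top a) with h1 | h1 <;>
    rcases Nat.eq_zero_or_pos (p.bot a) with h2 | h2
  · have e1 := rowSum_succ p.top t a
    have e2 := rowSum_succ p.bot t a
    rw [h1, rowSum_zero] at e1
    rw [h2, rowSum_zero] at e2
    have := h' 1 le_rfl Fintype.one_lt_card
    simp only [zero_add] at e1 e2
    linarith
  · rw [h1, rowSum_zero]
    linarith [(h' _ h2 (Fin.is_lt _)).2]
  · rw [h2, rowSum_zero]
    linarith [(h' _ h1 (Fin.is_lt _)).1]
  · linarith [(h' _ h2 (Fin.is_lt _)).2, (h' _ h1 (Fin.is_lt _)).1]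

/-- If both rows had the same last letter, the sums over the first d-1 letters would coincide,
against their opposite signs. Hence the loser is a genuine next letter and not the default value of
`nextLetter`. -/
theorem CombData.IsSuspension.bot_lastLetter_lt {p : CombData A} {t : A → ℝ}
    (h : p.IsSuspension t) : (p.bot (lastLetter p.top) : ℕ) + 1 < Fintype.card A := by
  by_contra hc
  have h1 := Fin.is_lt (p.bot (lastLetter p.top))
  have h2 : lastLetter p.bot = lastLetter p.top := p.bot.injective (Fin.ext (by
    rw [apply_lastLetter]; omega))
  have := Fintype.one_lt_card (α := A)
  have h3 := h (Fintype.card A - 1) (by omega) (by omega)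
  rw [topSum_eq_rowSum, botSum_eq_rowSum, rowSum_card_sub_one, rowSum_card_sub_one, h2] at h3
  linarith

theorem CombData.IsSuspension.top_lastLetter_lt {p : CombData A} {t : A → ℝ}
    (h : p.IsSuspension t) : (p.top (lastLetter p.bot) : ℕ) + 1 < Fintype.card A := by
  by_contra hc
  have h1 := Fin.is_lt (p.top (lastLetter p.bot))
  have h2 : lastLetter p.top = lastLetter p.bot := p.top.injective (Fin.ext (by
    rw [apply_lastLetter]; omega))
  have := Fintype.one_lt_card (α := A)
  have h3 := h (Fintype.card A - 1) (by omega) (by omega)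
  rw [topSum_eq_rowSum, botSum_eq_rowSum, rowSum_card_sub_one, rowSum_card_sub_one, h2] at h3
  linarith

theorem winner_ne_loser {s : PiTau A} (h : s.1.IsSuspension s.2) : winner s ≠ loser s := by
  unfold loser winner
  split_ifs
  · exact ne_nextLetter h.bot_lastLetter_lt
  · exact ne_nextLetter h.top_lastLetter_lt

variable [DecidableEq A]

theorem backStep_of_isTopType {s : PiTau A} (ht : IsTopType s) : backStep s =
    (⟨s.1.top, s.1.bot.trans (moveLast (s.1.bot (lastLetter s.1.top)))⟩,
      Function.update s.2 (lastLetter s.1.top)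
        (s.2 (lastLetter s.1.top) + s.2 (nextLetter s.1.bot (lastLetter s.1.top)))) := by
  simp [backStep, winner, loser, ht]

theorem backStep_of_not_isTopType {s : PiTau A} (ht : ¬ IsTopType s) : backStep s =
    (⟨s.1.top.trans (moveLast (s.1.top (lastLetter s.1.bot))), s.1.bot⟩,
      Function.update s.2 (lastLetter s.1.bot)
        (s.2 (lastLetter s.1.bot) + s.2 (nextLetter s.1.top (lastLetter s.1.bot)))) := by
  simp [backStep, winner, loser, ht]

/-- After the step the rows end with the old winner and the old loser, and the next winner is one of
these two last letters. This persistence is what forces positivity of the matrices later. -/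
theorem winner_backStep {s : PiTau A} (h : s.1.IsSuspension s.2) :
    winner (backStep s) = winner s ∨ winner (backStep s) = loser s := by
  by_cases ht : IsTopType s
  · have e1 : winner s = lastLetter s.1.top := by simp [winner, ht]
    have e2 : loser s = nextLetter s.1.bot (lastLetter s.1.top) := by simp [loser, winner, ht]
    have e3 := lastLetter_trans_moveLast h.bot_lastLetter_lt
    rw [e1, e2, backStep_of_isTopType ht]
    unfold winner
    split_ifs <;> simp [e3]
  · have e1 : winner s = lastLetter s.1.bot := by simp [winner, ht]
    have e2 : loser s = nextLetter s.1.top (lastLetter s.1.bot) := by simp [loser, winner, ht]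
    have e3 := lastLetter_trans_moveLast h.top_lastLetter_lt
    rw [e1, e2, backStep_of_not_isTopType ht]
    unfold winner
    split_ifs <;> simp [e3]

/-- The only partial sum that was not already present is the total sum, and the type of the arrow is
chosen so that this sum has the sign required in the row where it appears. -/
theorem CombData.IsSuspension.backStep {s : PiTau A} (h : s.1.IsSuspension s.2)
    (h0 : ∑ a, s.2 a ≠ 0) : (backStep s).1.IsSuspension (backStep s).2 := by
  intro k hk1 hk2
  have h' : ∀ k : ℕ, 1 ≤ k → k < Fintype.card A →
      0 < rowSum s.1.top s.2 k ∧ rowSum s.1.bot s.2 k < 0 :=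
    fun k h1 h2 => by simpa [topSum_eq_rowSum, botSum_eq_rowSum] using h k h1 h2
  rw [topSum_eq_rowSum, botSum_eq_rowSum]
  by_cases ht : IsTopType s
  · rw [backStep_of_isTopType ht]
    simp only
    rw [rowSum_update_lastLetter _ _ _ hk2, rowSum_trans_moveLast h.bot_lastLetter_lt _ hk2]
    refine ⟨(h' k hk1 hk2).1, ?_⟩
    split_ifs
    · exact (h' k hk1 hk2).2
    · rcases (Nat.succ_le_of_lt hk2).lt_or_eq with hk3 | hk3
      · exact (h' (k + 1) (by omega) hk3).2
      · rw [show k + 1 = Fintype.card A from hk3, rowSum_card]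
        exact ht
  · rw [backStep_of_not_isTopType ht]
    simp only
    rw [rowSum_update_lastLetter _ _ _ hk2, rowSum_trans_moveLast h.top_lastLetter_lt _ hk2]
    refine ⟨?_, (h' k hk1 hk2).2⟩
    split_ifs
    · exact (h' k hk1 hk2).1
    · rcases (Nat.succ_le_of_lt hk2).lt_or_eq with hk3 | hk3
      · exact (h' (k + 1) (by omega) hk3).1
      · rw [show k + 1 = Fintype.card A from hk3, rowSum_card]
        exact lt_of_le_of_ne (not_lt.1 ht) (Ne.symm h0)

theorem heights_backStep {s : PiTau A} (h : s.1.IsSuspension s.2) :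
    (backStep s).1.heights (backStep s).2 =
      Function.update (s.1.heights s.2) (loser s)
        (s.1.heights s.2 (loser s) - s.1.heights s.2 (winner s)) := by
  ext b
  rw [CombData.heights_eq]
  by_cases ht : IsTopType s
  · have e1 : winner s = lastLetter s.1.top := by simp [winner, ht]
    have e2 : loser s = nextLetter s.1.bot (lastLetter s.1.top) := by simp [loser, winner, ht]
    have hlt := h.bot_lastLetter_lt
    rw [e1, e2, backStep_of_isTopType ht]
    simp only
    rw [rowSum_update_lastLetter _ _ _ (Fin.is_lt _), rowSum_trans_moveLast_apply hlt]
    by_cases hb : b = nextLetter s.1.bot (lastLetter s.1.top)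
    · subst hb
      simp only [if_true, Function.update_self, CombData.heights_eq]
      rw [apply_nextLetter hlt, rowSum_succ, apply_lastLetter, rowSum_card_sub_one]
      ring
    · simp [hb, CombData.heights_eq]
  · have e1 : winner s = lastLetter s.1.bot := by simp [winner, ht]
    have e2 : loser s = nextLetter s.1.top (lastLetter s.1.bot) := by simp [loser, winner, ht]
    have hlt := h.top_lastLetter_lt
    rw [e1, e2, backStep_of_not_isTopType ht]
    simp only
    rw [rowSum_update_lastLetter _ _ _ (Fin.is_lt _), rowSum_trans_moveLast_apply hlt]
    by_cases hb : b = nextLetter s.1.top (lastLetter s.1.bot)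
    · subst hb
      simp only [if_true, Function.update_self, CombData.heights_eq]
      rw [apply_nextLetter hlt, rowSum_succ, apply_lastLetter, rowSum_card_sub_one]
      ring
    · simp [hb, CombData.heights_eq]

end Dynamics

/-! ### Words, homology coordinates and matrices along the backward path. -/

section Words

variable {A : Type*} [Fintype A]

theorem intersection_sub (c : RelHomology A) (t t' : PuncturedHomology A) :
    intersection c (t - t') = intersection c t - intersection c t' := by
  simp [intersection, mul_sub]

theorem sum_map_flatMap {B C V : Type*} [AddCommMonoid V] (f : B → List C) (x : C → V)
    (L : List B) : ((L.flatMap f).map x).sum = (L.map fun b => ((f b).map x).sum).sum := by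
  induction L with
  | nil => simp
  | cons b L ih => simp [ih]

variable [DecidableEq A]

theorem sum_map_eq_sum_count (L : List A) (f : A → ℝ) :
    (L.map f).sum = ∑ b, (L.count b : ℝ) * f b := by
  induction L with
  | nil => simp
  | cons a L ih =>
    simp [ih, List.count_cons, add_mul, Finset.sum_add_distrib, add_comm]

theorem count_eq_sum_map (L : List A) (b : A) :
    (L.count b : ℝ) = (L.map fun a => if a = b then (1 : ℝ) else 0).sum := by
  simp [sum_map_eq_sum_count]

theorem length_eq_sum_count (L : List A) : (L.length : ℝ) = ∑ b, (L.count b : ℝ) := by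
  simpa using sum_map_eq_sum_count L fun _ => 1

variable [Nontrivial A]

/-- `(π, τ)` is a suspension datum for which the backward algorithm never stops. -/
def NeverStops (s : PiTau A) : Prop := s.1.IsSuspension s.2 ∧ HasBackwardRotationNumber s

/-- The heights `q^{(-n)}` of the rectangles at time `-n`. -/
def heightsAt (s : PiTau A) (n : ℕ) : A → ℝ := (backIter s n).1.heights (backIter s n).2

theorem backIter_succ (s : PiTau A) (n : ℕ) : backIter s (n + 1) = backStep (backIter s n) :=
  Function.iterate_succ_apply' _ _ _

theorem backIter_add (s : PiTau A) (m n : ℕ) :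
    backIter (backIter s m) n = backIter s (m + n) := by
  rw [add_comm]
  exact (Function.iterate_add_apply _ _ _ _).symm

theorem NeverStops.isSuspension {s : PiTau A} (h : NeverStops s) (n : ℕ) :
    (backIter s n).1.IsSuspension (backIter s n).2 := by
  induction n with
  | zero => exact h.1
  | succ n ih =>
    rw [backIter_succ]
    exact ih.backStep (h.2 n)

theorem NeverStops.backIter {s : PiTau A} (h : NeverStops s) (n : ℕ) :
    NeverStops (backIter s n) :=
  ⟨h.isSuspension n, fun m => by rw [backIter_add]; exact h.2 (n + m)⟩

theorem NeverStops.winner_ne_loser {s : PiTau A} (h : NeverStops s) (n : ℕ) :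
    winner (RauzyVeech.backIter s n) ≠ loser (RauzyVeech.backIter s n) :=
  RauzyVeech.winner_ne_loser (h.isSuspension n)

theorem NeverStops.heightsAt_pos {s : PiTau A} (h : NeverStops s) (n : ℕ) (a : A) :
    0 < heightsAt s n a := (h.isSuspension n).heights_pos a

theorem NeverStops.heightsAt_succ {s : PiTau A} (h : NeverStops s) (n : ℕ) :
    heightsAt s (n + 1) = Function.update (heightsAt s n) (loser (RauzyVeech.backIter s n))
      (heightsAt s n (loser (RauzyVeech.backIter s n))
        - heightsAt s n (winner (RauzyVeech.backIter s n))) := by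
  unfold heightsAt
  rw [backIter_succ]
  exact heights_backStep (h.isSuspension n)

theorem heightsAt_backIter (s : PiTau A) (m n : ℕ) :
    heightsAt (backIter s m) n = heightsAt s (m + n) := by
  simp only [heightsAt, backIter_add]

theorem chi_succ (s : PiTau A) (c : RelHomology A) (n : ℕ) :
    chi s c (n + 1) = Function.update (chi s c n) (loser (backIter s n))
      (chi s c n (loser (backIter s n)) - chi s c n (winner (backIter s n))) := by
  ext a
  by_cases ha : a = loser (backIter s n)
  · subst ha
    simp [chi, theta, intersection_sub]
  · simp [chi, theta, ha]

theorem chi_heights (s : PiTau A) (n : ℕ) (a : A) :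
    chi s (s.1.heights s.2) n a = pVert s (theta s n a) := rfl

theorem NeverStops.pVert_theta {s : PiTau A} (h : NeverStops s) (n : ℕ) (a : A) :
    pVert s (theta s n a) = heightsAt s n a := by
  rw [← chi_heights]
  refine congrFun ?_ a
  induction n with
  | zero => rw [chi_zero]; rfl
  | succ n ih => rw [chi_succ, h.heightsAt_succ, ih]

/-- The value of the loser becomes x_ℓ - x_w while ℓ becomes a two-letter word in ℓ and w, so the
total is again x_ℓ. Heights and coordinates χ both follow this update rule. -/
theorem sum_map_substLetter {V : Type*} [AddCommGroup V] {s : PiTau A}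
    (h : winner s ≠ loser s) (x : A → V) (a : A) :
    ((substLetter s a).map (Function.update x (loser s) (x (loser s) - x (winner s)))).sum
      = x a := by
  unfold substLetter
  split_ifs with h1 h2 <;> simp [*]

theorem word_succ (s : PiTau A) (a : A) (n : ℕ) :
    word s a (n + 1) = (word s a n).flatMap (substLetter (backIter s n)) := rfl

/-- This cuts the word at a later stage into blocks indexed by the letters of an earlier one, as
needed for the averaging at an intermediate time. -/
theorem word_add (s : PiTau A) (a : A) (m n : ℕ) :
    word s a (m + n) = (word s a m).flatMap fun b => word (backIter s m) b n := by
  induction n with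
  | zero => simp [word]
  | succ n ih =>
    rw [← add_assoc, word_succ, ih, List.flatMap_assoc]
    simp only [word_succ, backIter_add]

theorem word_ne_nil (s : PiTau A) (a : A) (n : ℕ) : word s a n ≠ [] := by
  induction n with
  | zero => simp [word]
  | succ n ih =>
    obtain ⟨b, hb⟩ := List.exists_mem_of_ne_nil _ ih
    rw [word_succ, ne_eq, List.flatMap_eq_nil_iff, not_forall]
    refine ⟨b, fun hh => ?_⟩
    have := hh hb
    unfold substLetter at this
    split_ifs at this

theorem NeverStops.sum_heightsAt_word {s : PiTau A} (h : NeverStops s) (a : A) (n : ℕ) :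
    ((word s a n).map (heightsAt s n)).sum = s.1.heights s.2 a := by
  induction n with
  | zero => simp [word, heightsAt, RauzyVeech.backIter]
  | succ n ih =>
    rw [word_succ, sum_map_flatMap, h.heightsAt_succ]
    simpa only [sum_map_substLetter (h.winner_ne_loser n)] using ih

theorem kz_nonneg (s : PiTau A) (n : ℕ) (a b : A) : 0 ≤ kz s n a b :=
  le_trans (by rw [Matrix.one_apply]; split_ifs <;> norm_num) (one_le_kz s n a b)

theorem arrowMatrix_apply (s : PiTau A) (a b : A) : arrowMatrix s a b =
    (if a = b then 1 else 0) + if loser s = a ∧ winner s = b then 1 else 0 := by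
  simp [arrowMatrix, Matrix.one_apply, Matrix.single_apply]

theorem kz_succ_apply (s : PiTau A) (n : ℕ) (a b : A) : kz s (n + 1) a b =
    kz s n a b + if winner (backIter s n) = b then kz s n a (loser (backIter s n)) else 0 := by
  rw [kz, Matrix.mul_apply]
  simp only [arrowMatrix_apply, mul_add, Finset.sum_add_distrib]
  congr 1
  · simp
  · by_cases hb : winner (backIter s n) = b <;> simp [hb]

theorem count_substLetter {s : PiTau A} (h : winner s ≠ loser s) (a b : A) :
    ((substLetter s a).count b : ℝ) = arrowMatrix s a b := by
  rw [arrowMatrix_apply, count_eq_sum_map]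
  unfold substLetter
  by_cases h1 : a = loser s
  · subst h1
    by_cases h2 : IsTopType s <;> simp [h2, add_comm]
  · simp [h1, Ne.symm h1]

/-- Counting letters turns the substitution of an arrow into its matrix, and composition of
substitutions into the matrix product. -/
theorem NeverStops.count_word {s : PiTau A} (h : NeverStops s) (n : ℕ) (a b : A) :
    ((word s a n).count b : ℝ) = kz s n a b := by
  induction n generalizing b with
  | zero => simp [word, kz, Matrix.one_apply, count_eq_sum_map]
  | succ n ih =>
    rw [count_eq_sum_map, word_succ, sum_map_flatMap, sum_map_eq_sum_count, kz, Matrix.mul_apply]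
    simp only [← count_eq_sum_map, ih, count_substLetter (h.winner_ne_loser n)]

theorem kz_add (s : PiTau A) (m n : ℕ) : kz s (m + n) = kz s m * kz (backIter s m) n := by
  induction n with
  | zero => simp [kz]
  | succ n ih => rw [← add_assoc, kz, ih, kz, Matrix.mul_assoc, backIter_add]

theorem NeverStops.kz_mulVec_heightsAt {s : PiTau A} (h : NeverStops s) (n : ℕ) :
    kz s n *ᵥ heightsAt s n = s.1.heights s.2 := by
  ext a
  rw [← h.sum_heightsAt_word a n, sum_map_eq_sum_count]
  simp only [h.count_word, Matrix.mulVec, dotProduct]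

theorem NeverStops.det_kz {s : PiTau A} (h : NeverStops s) (n : ℕ) : (kz s n).det = 1 := by
  induction n with
  | zero => simp [kz]
  | succ n ih =>
    rw [kz, Matrix.det_mul, ih, one_mul]
    exact Matrix.det_transvection_of_ne _ _ (h.winner_ne_loser n).symm 1

end Words

/-! ### Norms of the Kontsevich–Zorich matrices. -/

section MatNorm

variable {A : Type*} [Fintype A]

theorem matNorm_nonneg (B : Matrix A A ℝ) : 0 ≤ matNorm B :=
  Finset.sum_nonneg fun _ _ => Finset.sum_nonneg fun _ _ => abs_nonneg _

theorem matNorm_transpose (B : Matrix A A ℝ) : matNorm Bᵀ = matNorm B := by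
  simp only [matNorm, Matrix.transpose_apply]
  exact Finset.sum_comm

theorem abs_le_matNorm (B : Matrix A A ℝ) (a b : A) : |B a b| ≤ matNorm B :=
  (Finset.single_le_sum (f := fun b => |B a b|) (fun _ _ => abs_nonneg _)
    (Finset.mem_univ b)).trans (Finset.single_le_sum (f := fun a => ∑ b, |B a b|)
      (fun _ _ => Finset.sum_nonneg fun _ _ => abs_nonneg _) (Finset.mem_univ a))

theorem matNorm_mul_le (B C : Matrix A A ℝ) : matNorm (B * C) ≤ matNorm B * matNorm C := by
  calc matNorm (B * C) ≤ ∑ a, ∑ c, ∑ b, |B a b| * |C b c| := by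
        refine Finset.sum_le_sum fun a _ => Finset.sum_le_sum fun c _ => ?_
        rw [Matrix.mul_apply]
        refine (Finset.abs_sum_le_sum_abs _ _).trans_eq ?_
        simp only [abs_mul]
    _ = ∑ a, ∑ b, |B a b| * ∑ c, |C b c| := by
        refine Finset.sum_congr rfl fun a _ => ?_
        rw [Finset.sum_comm]
        simp only [Finset.mul_sum]
    _ ≤ ∑ a, ∑ b, |B a b| * matNorm C := by
        gcongr with a _ b _
        exact Finset.single_le_sum (f := fun b => ∑ c, |C b c|)
          (fun _ _ => Finset.sum_nonneg fun _ _ => abs_nonneg _) (Finset.mem_univ b)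
    _ = matNorm B * matNorm C := by
        simp only [matNorm, Finset.sum_mul]

/-- Coefficients of the inverse of a matrix of determinant `1`, by Cramer's rule. -/
theorem abs_inv_apply_le [DecidableEq A] {B : Matrix A A ℝ} (hB : B.det = 1) (h1 : 1 ≤ matNorm B)
    (a b : A) :
    |B⁻¹ a b| ≤ (Fintype.card A).factorial * matNorm B ^ Fintype.card A := by
  rw [Matrix.inv_def, hB]
  simp only [Ring.inverse_one, one_smul, Matrix.adjugate_apply]
  have := Matrix.det_le (A := B.updateRow b (Pi.single a 1)) (abv := AbsoluteValue.abs)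
    (x := matNorm B) (fun i j => ?_)
  · simpa using this
  · rw [Matrix.updateRow_apply]
    split_ifs
    · rw [Pi.single_apply]
      split_ifs
      · simpa using h1
      · simpa using zero_le_one.trans h1
    · exact abs_le_matNorm B i j

variable [Nontrivial A] [DecidableEq A]

theorem matNorm_kz (s : PiTau A) (n : ℕ) : matNorm (kz s n) = ∑ a, ∑ b, kz s n a b := by
  simp only [matNorm, abs_of_nonneg (kz_nonneg s n _ _)]

theorem matNorm_kz_zero (s : PiTau A) : matNorm (kz s 0) = Fintype.card A := by
  rw [matNorm_kz]
  simp [kz, Matrix.one_apply]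

theorem matNorm_kz_le_succ (s : PiTau A) (n : ℕ) : matNorm (kz s n) ≤ matNorm (kz s (n + 1)) := by
  rw [matNorm_kz, matNorm_kz]
  gcongr with a _ b _
  rw [kz_succ_apply]
  split_ifs
  · linarith [kz_nonneg s n a (loser (backIter s n))]
  · simp

theorem matNorm_kz_mono (s : PiTau A) : Monotone fun n => matNorm (kz s n) :=
  monotone_nat_of_le_succ (matNorm_kz_le_succ s)

/-- A step adds the column of the loser to the column of the winner, so the sum of the entries at
most doubles. This lets an intermediate time be selected by the size of its matrix. -/
theorem matNorm_kz_succ_le (s : PiTau A) (n : ℕ) :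
    matNorm (kz s (n + 1)) ≤ 2 * matNorm (kz s n) := by
  rw [matNorm_kz, matNorm_kz, two_mul, ← Finset.sum_add_distrib]
  gcongr with a _
  simp only [kz_succ_apply, Finset.sum_add_distrib, Finset.sum_ite_eq, Finset.mem_univ, if_true]
  gcongr
  exact Finset.single_le_sum (f := fun b => kz s n a b) (fun _ _ => kz_nonneg _ _ _ _)
    (Finset.mem_univ _)

theorem two_le_matNorm_kz (s : PiTau A) (n : ℕ) : 2 ≤ matNorm (kz s n) := by
  refine le_trans ?_ (matNorm_kz_mono s (Nat.zero_le n))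
  simp only [matNorm_kz_zero]
  exact_mod_cast Nat.succ_le_of_lt (Fintype.one_lt_card (α := A))

theorem NeverStops.length_word_le {s : PiTau A} (h : NeverStops s) (a : A) (n : ℕ) :
    ((word s a n).length : ℝ) ≤ matNorm (kz s n) := by
  rw [length_eq_sum_count, matNorm_kz]
  simp only [h.count_word]
  exact Finset.single_le_sum (f := fun a => ∑ b, kz s n a b)
    (fun _ _ => Finset.sum_nonneg fun _ _ => kz_nonneg _ _ _ _) (Finset.mem_univ a)

end MatNorm

/-! ### Positivity of the matrix of a concatenation of 2d complete paths. -/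

section Positivity

variable {A : Type*} [Fintype A] [Nontrivial A] [DecidableEq A]

/-- The letters `b` such that `B(-n, 0)_{ab} ≥ 1`. -/
def kzSupport (s : PiTau A) (a : A) (n : ℕ) : Finset A := {b | 1 ≤ kz s n a b}

theorem mem_kzSupport {s : PiTau A} {a b : A} {n : ℕ} :
    b ∈ kzSupport s a n ↔ 1 ≤ kz s n a b := by simp [kzSupport]

theorem kz_apply_le_succ (s : PiTau A) (n : ℕ) (a b : A) : kz s n a b ≤ kz s (n + 1) a b := by
  rw [kz_succ_apply]
  split_ifs
  · linarith [kz_nonneg s n a (loser (backIter s n))]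
  · simp

theorem kzSupport_mono (s : PiTau A) (a : A) : Monotone (kzSupport s a) :=
  monotone_nat_of_le_succ fun n b hb =>
    mem_kzSupport.2 ((mem_kzSupport.1 hb).trans (kz_apply_le_succ s n a b))

theorem self_mem_kzSupport (s : PiTau A) (a : A) (n : ℕ) : a ∈ kzSupport s a n :=
  mem_kzSupport.2 (by simpa using one_le_kz s n a a)

theorem winner_mem_kzSupport {s : PiTau A} {a : A} {n : ℕ}
    (h : loser (backIter s n) ∈ kzSupport s a n) :
    winner (backIter s n) ∈ kzSupport s a (n + 1) := by
  rw [mem_kzSupport] at h ⊢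
  rw [kz_succ_apply, if_pos rfl]
  linarith [kz_nonneg s n a (winner (backIter s n))]

/-- Every letter wins between the times `-n` and `-m`. -/
def IsCompleteBetween (s : PiTau A) (m n : ℕ) : Prop :=
  ∀ a : A, ∃ i, m ≤ i ∧ i < n ∧ winner (backIter s i) = a

/-- If the support did not grow, then a winner outside of it would beat only letters outside of it;
since the winner of an arrow is the winner or the loser of the next one in time, all the subsequent
winners would be outside of the support. -/
theorem kzSupport_ssubset {s : PiTau A} (h : NeverStops s) (a : A) {t₀ t₁ t₂ : ℕ}
    (h₀ : IsCompleteBetween s t₀ t₁) (h₁ : IsCompleteBetween s t₁ t₂)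
    (hne : kzSupport s a t₀ ≠ Finset.univ) : kzSupport s a t₀ ⊂ kzSupport s a t₂ := by
  obtain ⟨c, hc⟩ : ∃ c, c ∉ kzSupport s a t₀ := by
    by_contra! hh
    exact hne (Finset.eq_univ_iff_forall.2 hh)
  obtain ⟨i₀, hi₀, hi₀', hw⟩ := h₀ c
  -- The second path is used for the letter `a` itself, which always belongs to its own support: its
  -- victory at time `j` contradicts `key`.
  obtain ⟨j, hj, hj', hwj⟩ := h₁ a
  refine lt_of_le_of_ne (kzSupport_mono s a (by omega)) fun heq => ?_
  have key : ∀ i, i₀ ≤ i → i < t₂ → winner (backIter s i) ∉ kzSupport s a t₀ := by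
    intro i hi
    induction i, hi using Nat.le_induction with
    | base => intro _; rwa [hw]
    | succ i hi ih =>
      intro hi2
      have h1 := ih (by omega)
      have h2 : loser (backIter s i) ∉ kzSupport s a t₀ := fun hl => by
        have h3 := winner_mem_kzSupport (kzSupport_mono s a (hi₀.trans hi) hl)
        have h4 := kzSupport_mono s a (show i + 1 ≤ t₂ by omega) h3
        rw [← heq] at h4
        exact h1 h4
      rw [backIter_succ]
      rcases winner_backStep (h.isSuspension i) with e | e <;> rwa [e]
  exact key j (by omega) hj' (hwj ▸ self_mem_kzSupport s a t₀)

/-- Two complete paths enlarge the support of a row by at least one letter until it is full, so d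
such pairs suffice. -/
theorem one_le_kz_of_isCompleteBetween {s : PiTau A} (h : NeverStops s) {T : ℕ → ℕ}
    (hT : ∀ j, IsCompleteBetween s (T j) (T (j + 1))) (a b : A) :
    1 ≤ kz s (T (2 * Fintype.card A)) a b := by
  have key : ∀ j, kzSupport s a (T (2 * j)) = Finset.univ ∨
      j ≤ (kzSupport s a (T (2 * j))).card := by
    intro j
    induction j with
    | zero => simp
    | succ j ih =>
      by_cases hne : kzSupport s a (T (2 * j)) = Finset.univ
      · left
        rw [← Finset.univ_subset_iff, ← hne]
        obtain ⟨i, hi, hi', _⟩ := hT (2 * j) a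
        obtain ⟨i', hi1, hi1', _⟩ := hT (2 * j + 1) a
        refine kzSupport_mono s a (?_ : _ ≤ T (2 * j + 1 + 1))
        omega
      · right
        have hlt := Finset.card_lt_card (kzSupport_ssubset h a (hT (2 * j)) (hT (2 * j + 1)) hne)
        exact (Nat.succ_le_succ (ih.resolve_left hne)).trans hlt
  have hu : kzSupport s a (T (2 * Fintype.card A)) = Finset.univ :=
    (key _).elim id fun hc => Finset.eq_univ_of_card _ (le_antisymm (Finset.card_le_univ _) hc)
  exact mem_kzSupport.1 (hu ▸ Finset.mem_univ b)

theorem IsInfinitelyComplete.accTime_spec {s : PiTau A} (h : IsInfinitelyComplete s) (k : ℕ) :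
    accTime s k < accTime s (k + 1) ∧ IsCompleteBetween s (accTime s k) (accTime s (k + 1)) := by
  -- Completeness makes the set nonempty, so `sInf` is attained and is not the default value 0.
  refine Nat.sInf_mem (s := {m | accTime s k < m ∧
      ∀ a : A, ∃ i, accTime s k ≤ i ∧ i < m ∧ winner (backIter s i) = a}) ?_
  choose f hf hf' using fun a => h a (accTime s k)
  refine ⟨(Finset.univ.sup f) + 1 + accTime s k, by omega, fun a => ⟨f a, hf a, ?_, hf' a⟩⟩
  have := Finset.le_sup (f := f) (Finset.mem_univ a)
  omega

theorem IsInfinitelyComplete.accTime_strictMono {s : PiTau A} (h : IsInfinitelyComplete s) :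
    StrictMono (accTime s) := strictMono_nat_of_lt_succ fun k => (h.accTime_spec k).1

/-- The matrix of a concatenation of `2d` complete paths is positive. -/
theorem NeverStops.one_le_kz_accTime {s : PiTau A} (h : NeverStops s)
    (hc : IsInfinitelyComplete s) (k : ℕ) (a b : A) :
    1 ≤ kz (RauzyVeech.backIter s (accTime s k))
      (accTime s (k + 2 * Fintype.card A) - accTime s k) a b := by
  refine one_le_kz_of_isCompleteBetween (h.backIter _)
    (T := fun j => accTime s (k + j) - accTime s k) (fun j a => ?_) a b
  obtain ⟨i, hi, hi', hw⟩ := (hc.accTime_spec (k + j)).2 a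
  have := hc.accTime_strictMono.monotone (Nat.le_add_right k j)
  refine ⟨i - accTime s k, by omega, ?_, ?_⟩
  · simp only [← add_assoc]
    omega
  · rw [backIter_add, ← hw]
    congr 2
    omega

end Positivity

/-! ### Upper bounds for the heights of the rectangles. -/

section Balance

variable {A : Type*} [Fintype A] [Nontrivial A] [DecidableEq A]

theorem le_kz_mulVec {s : PiTau A} {n : ℕ} {x : A → ℝ}
    (hx : ∀ a, 0 ≤ x a) (a : A) : x a ≤ (kz s n *ᵥ x) a := by
  refine le_trans ?_ (Finset.single_le_sum (f := fun b => kz s n a b * x b)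
    (fun b _ => mul_nonneg (kz_nonneg _ _ _ _) (hx b)) (Finset.mem_univ a))
  have := one_le_kz s n a a
  rw [Matrix.one_apply_eq] at this
  exact le_mul_of_one_le_left (hx a) this

theorem NeverStops.heightsAt_antitone {s : PiTau A} (h : NeverStops s) {m n : ℕ} (hmn : m ≤ n)
    (a : A) : heightsAt s n a ≤ heightsAt s m a := by
  obtain ⟨k, rfl⟩ := Nat.exists_eq_add_of_le hmn
  rw [← heightsAt_backIter]
  refine (le_kz_mulVec (s := RauzyVeech.backIter s m) (n := k) (fun b =>
    ((h.backIter m).heightsAt_pos k b).le) a).trans_eq ?_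
  rw [(h.backIter m).kz_mulVec_heightsAt]
  rfl

/-- By positivity of the intermediate matrix, the height of `b` at the later stage is at most every
height at stage `accTime s k`; it then bounds from below each term of the identity q = B q^(-m). -/
theorem NeverStops.heightsAt_mul_matNorm_le {s : PiTau A} (h : NeverStops s)
    (hc : IsInfinitelyComplete s) (k : ℕ) (b : A) :
    heightsAt s (accTime s (k + 2 * Fintype.card A)) b * matNorm (kz s (accTime s k)) ≤
      ∑ a, s.1.heights s.2 a := by
  set m := accTime s k
  set n := accTime s (k + 2 * Fintype.card A)
  have hmn : m ≤ n := hc.accTime_strictMono.monotone (Nat.le_add_right _ _)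
  have h1 : ∀ c, heightsAt s n b ≤ heightsAt s m c := by
    intro c
    have e := congrFun ((h.backIter m).kz_mulVec_heightsAt (n - m)) c
    rw [heightsAt_backIter, Nat.add_sub_cancel' hmn] at e
    change _ = heightsAt s m c at e
    rw [← e]
    refine le_trans ?_ (Finset.single_le_sum
      (f := fun b => kz (RauzyVeech.backIter s m) (n - m) c b * heightsAt s n b)
      (fun b _ => mul_nonneg (kz_nonneg _ _ _ _) (h.heightsAt_pos n b).le) (Finset.mem_univ b))
    exact le_mul_of_one_le_left (h.heightsAt_pos n b).le (h.one_le_kz_accTime hc k c b)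
  rw [← h.kz_mulVec_heightsAt m, matNorm_kz, Finset.mul_sum]
  refine Finset.sum_le_sum fun a _ => ?_
  rw [Finset.mul_sum, Matrix.mulVec, dotProduct]
  refine Finset.sum_le_sum fun c _ => ?_
  rw [mul_comm]
  exact mul_le_mul_of_nonneg_left (h1 c) (kz_nonneg _ _ _ _)

/-- The heights of the rectangles at time `-n` are all of order at most `‖B(-n, 0)‖^{-1 + ε}`. -/
theorem IsDualRothType.heightsAt_le {s : PiTau A} (hs : s.1.IsSuspension s.2)
    (hR : IsDualRothType s) {ε : ℝ} (hε : 0 < ε) : ∃ C : ℝ, 0 < C ∧ ∀ n b,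
      heightsAt s n b ≤ C * matNorm (kz s n) ^ (-1 + ε) := by
  have h : NeverStops s := ⟨hs, hR.rotation⟩
  have hc := hR.complete
  set r := 2 * Fintype.card A
  -- At most r + 1 accelerated steps will each cost a factor N^δ, for a total of N^ε.
  set δ : ℝ := ε / (r + 1)
  have hδ : 0 < δ := by positivity
  obtain ⟨C₀, -, hg⟩ := hR.growth δ hδ
  set C₁ := max C₀ 1
  have hC₁ : 1 ≤ C₁ := le_max_right _ _
  set Q := ∑ a, s.1.heights s.2 a
  have hq : ∀ a, 0 < s.1.heights s.2 a := hs.heights_pos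
  have hQ : 0 < Q := Finset.sum_pos (fun a _ => hq a) Finset.univ_nonempty
  have hN := one_le_matNorm_kz s
  have hmono := matNorm_kz_mono s
  refine ⟨Q * Fintype.card A * C₁ ^ (r + 1), by positivity, fun n b => ?_⟩
  obtain ⟨k, hk, hk'⟩ : ∃ k, accTime s k ≤ n ∧ n < accTime s (k + 1) := by
    refine ⟨Nat.findGreatest (fun k => accTime s k ≤ n) n,
      Nat.findGreatest_spec (P := fun k => accTime s k ≤ n) (Nat.zero_le n) (Nat.zero_le n), ?_⟩
    -- The search up to `n` is long enough because `accTime s j ≥ j`.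
    by_contra! hcon
    have h1 := Nat.le_findGreatest (P := fun k => accTime s k ≤ n)
      ((hc.accTime_strictMono.le_apply).trans hcon) hcon
    omega
  have hd : (1 : ℝ) ≤ Fintype.card A := by exact_mod_cast Fintype.card_pos
  have h1 : heightsAt s n b * matNorm (kz s (accTime s (k - r))) ≤ Q * Fintype.card A := by
    rcases le_or_gt r k with hrk | hrk
    · have h2 := h.heightsAt_mul_matNorm_le hc (k - r) b
      rw [Nat.sub_add_cancel hrk] at h2
      calc _ ≤ heightsAt s (accTime s k) b * matNorm (kz s (accTime s (k - r))) :=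
            mul_le_mul_of_nonneg_right (h.heightsAt_antitone hk b) (matNorm_nonneg _)
        _ ≤ Q := h2
        _ ≤ Q * Fintype.card A := le_mul_of_one_le_right hQ.le hd
    -- With fewer than r accelerated steps, the truncated `k - r` is 0 and the matrix is the
    -- identity, of norm d: hence the factor `Fintype.card A`.
    · rw [Nat.sub_eq_zero_of_le hrk.le]
      change _ * matNorm (kz s 0) ≤ _
      rw [matNorm_kz_zero]
      gcongr
      exact (h.heightsAt_antitone (Nat.zero_le n) b).trans
        (Finset.single_le_sum (f := s.1.heights s.2) (fun a _ => (hq a).le) (Finset.mem_univ b))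
  set N := matNorm (kz s n)
  have hN1 : 1 ≤ N := hN n
  have hP : 1 ≤ C₁ * N ^ δ := one_le_mul_of_one_le_of_one_le hC₁ (Real.one_le_rpow hN1 hδ.le)
  -- Each accelerated step multiplies the norm by at most C₁ N^δ: the growth condition is applied at
  -- a stage not beyond `n`, where the norm is at most N.
  have h2 : ∀ j, k - r + j ≤ k + 1 → matNorm (kz s (accTime s (k - r + j))) ≤
      matNorm (kz s (accTime s (k - r))) * (C₁ * N ^ δ) ^ j := by
    intro j
    induction j with
    | zero => simp
    | succ j ih =>
      intro hj
      have hlt := (hc.accTime_spec (k - r + j)).1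
      have e := kz_add s (accTime s (k - r + j))
        (accTime s (k - r + j + 1) - accTime s (k - r + j))
      rw [Nat.add_sub_cancel' hlt.le] at e
      rw [← add_assoc, e]
      refine (matNorm_mul_le _ _).trans ?_
      rw [pow_succ, ← mul_assoc]
      refine mul_le_mul (ih (by omega)) ((hg (k - r + j)).trans ?_) (matNorm_nonneg _)
        (mul_nonneg (matNorm_nonneg _) (by positivity))
      refine mul_le_mul (le_max_left _ _) (Real.rpow_le_rpow (matNorm_nonneg _) ?_ hδ.le)
        (Real.rpow_nonneg (matNorm_nonneg _) _) (by positivity)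
      exact hmono ((hc.accTime_strictMono.monotone (by omega)).trans hk)
  have h3 : N ≤ matNorm (kz s (accTime s (k - r))) * (C₁ ^ (r + 1) * N ^ ε) := by
    calc N ≤ matNorm (kz s (accTime s (k - r + (k + 1 - (k - r))))) := by
          refine hmono (hk'.le.trans_eq ?_)
          congr 1
          omega
      _ ≤ matNorm (kz s (accTime s (k - r))) * (C₁ * N ^ δ) ^ (k + 1 - (k - r)) :=
          h2 _ (by omega)
      _ ≤ matNorm (kz s (accTime s (k - r))) * (C₁ * N ^ δ) ^ (r + 1) := by
          refine mul_le_mul_of_nonneg_left ?_ (matNorm_nonneg _)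
          exact pow_le_pow_right₀ hP (by omega)
      _ = _ := by
          rw [mul_pow, ← Real.rpow_natCast (N ^ δ), ← Real.rpow_mul (by positivity)]
          congr 3
          simp only [δ]
          push_cast
          field_simp
  have hN0 : 0 < N := by positivity
  rw [Real.rpow_add hN0, Real.rpow_neg_one]
  have h4 : heightsAt s n b * N ≤ Q * Fintype.card A * (C₁ ^ (r + 1) * N ^ ε) := by
    calc _ ≤ heightsAt s n b * (matNorm (kz s (accTime s (k - r))) * (C₁ ^ (r + 1) * N ^ ε)) :=
          mul_le_mul_of_nonneg_left h3 (h.heightsAt_pos n b).le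
      _ = heightsAt s n b * matNorm (kz s (accTime s (k - r))) * (C₁ ^ (r + 1) * N ^ ε) := by ring
      _ ≤ _ := mul_le_mul_of_nonneg_right h1 (by positivity)
  rw [show Q * Fintype.card A * C₁ ^ (r + 1) * (N⁻¹ * N ^ ε) =
    Q * Fintype.card A * (C₁ ^ (r + 1) * N ^ ε) / N by field_simp, le_div_iff₀ hN0]
  exact h4

end Balance

/-! ### Broken lines as graphs of piecewise linear functions. -/

section PiecewiseLinear

variable {A : Type*}

/-- The continuous piecewise linear function which vanishes at `0` and whose graph is the broken
line of the successive vectors `(h b, c b)`, for the letters `b` of a word. -/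
def piecewiseLinear (h c : A → ℝ) : List A → ℝ → ℝ
  | [], _ => 0
  | b :: L, x => if x ≤ h b then c b / h b * x else c b + piecewiseLinear h c L (x - h b)

variable {h c : A → ℝ}

theorem sum_map_nonneg_of_pos (hh : ∀ b, 0 < h b) (L : List A) : 0 ≤ (L.map h).sum :=
  List.sum_nonneg fun x hx => by
    obtain ⟨b, -, rfl⟩ := List.mem_map.1 hx
    exact (hh b).le

theorem piecewiseLinear_zero (hh : ∀ b, 0 < h b) (L : List A) : piecewiseLinear h c L 0 = 0 := by
  cases L with
  | nil => rfl
  | cons b L => simp [piecewiseLinear, (hh b).le]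

theorem continuous_piecewiseLinear (hh : ∀ b, 0 < h b) (L : List A) :
    Continuous (piecewiseLinear h c L) := by
  induction L with
  | nil => exact continuous_const
  | cons b L ih =>
    refine Continuous.if_le (by fun_prop) (by fun_prop) continuous_id continuous_const ?_
    rintro x rfl
    simp [piecewiseLinear_zero hh, (hh b).ne']

theorem piecewiseLinear_append_of_le (hh : ∀ b, 0 < h b) (L L' : List A) {x : ℝ} (hx : 0 ≤ x)
    (hx' : x ≤ (L.map h).sum) :
    piecewiseLinear h c (L ++ L') x = piecewiseLinear h c L x := by
  induction L generalizing x with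
  | nil =>
    obtain rfl : x = 0 := le_antisymm (by simpa using hx') hx
    simp [piecewiseLinear_zero hh]
  | cons b L ih =>
    simp only [List.cons_append, piecewiseLinear]
    split_ifs with hb
    · rfl
    · rw [ih (by linarith)]
      simp only [List.map_cons, List.sum_cons] at hx'
      linarith

theorem piecewiseLinear_append_of_ge (hh : ∀ b, 0 < h b) (L L' : List A) {x : ℝ}
    (hx : (L.map h).sum ≤ x) : piecewiseLinear h c (L ++ L') x =
      (L.map c).sum + piecewiseLinear h c L' (x - (L.map h).sum) := by
  induction L generalizing x with
  | nil => simp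
  | cons b L ih =>
    simp only [List.map_cons, List.sum_cons] at hx ⊢
    have h0 := sum_map_nonneg_of_pos hh L
    simp only [List.cons_append, piecewiseLinear]
    split_ifs with hb
    · obtain rfl : x = h b := by linarith
      have h1 : (L.map h).sum = 0 := by linarith
      have h2 := ih (x := 0) h1.le
      rw [piecewiseLinear_zero hh, h1, sub_zero] at h2
      rw [h1, add_zero, sub_self, div_mul_cancel₀ _ (hh b).ne']
      rw [piecewiseLinear_zero hh] at h2 ⊢
      linarith
    · rw [ih (by linarith), add_assoc, sub_sub]

theorem abs_piecewiseLinear_le (hh : ∀ b, 0 < h b) (L : List A) {x : ℝ} (hx : 0 ≤ x) :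
    |piecewiseLinear h c L x| ≤ (L.map fun b => |c b|).sum := by
  induction L generalizing x with
  | nil => simp [piecewiseLinear]
  | cons b L ih =>
    simp only [piecewiseLinear, List.map_cons, List.sum_cons]
    split_ifs with hb
    · have h1 : |c b / h b * x| ≤ |c b| := by
        rw [div_mul_eq_mul_div, mul_div_assoc, abs_mul]
        refine mul_le_of_le_one_right (abs_nonneg _) ?_
        rw [abs_of_nonneg (div_nonneg hx (hh b).le)]
        exact (div_le_one (hh b)).2 hb
      have h2 : 0 ≤ (L.map fun b => |c b|).sum := List.sum_nonneg fun x hx => by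
        obtain ⟨b, -, rfl⟩ := List.mem_map.1 hx
        exact abs_nonneg _
      linarith
    · exact (abs_add_le _ _).trans (by linarith [ih (x := x - h b) (by linarith)])

/-- The broken line with successive sides `p b`, for the letters `b` of a word. -/
def polyline {E : Type*} [AddCommGroup E] [Module ℝ E] (p : A → E) (L : List A) : Set E :=
  ⋃ j ∈ Finset.range L.length,
    segment ℝ ((L.take j).map p).sum ((L.take (j + 1)).map p).sum

theorem image_polyline {E F : Type*} [AddCommGroup E] [Module ℝ E] [AddCommGroup F] [Module ℝ F]
    (f : E →ₗ[ℝ] F) (p : A → E) (L : List A) :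
    f '' polyline p L = polyline (fun a => f (p a)) L := by
  simp only [polyline, image_iUnion]
  refine iUnion_congr fun j => iUnion_congr fun _ => ?_
  have := image_segment ℝ f.toAffineMap ((L.take j).map p).sum ((L.take (j + 1)).map p).sum
  simpa [map_list_sum, Function.comp_def] using this

theorem mem_polyline_cons {E : Type*} [AddCommGroup E] [Module ℝ E] (p : A → E) (b : A)
    (L : List A) (z : E) :
    z ∈ polyline p (b :: L) ↔ z ∈ segment ℝ 0 (p b) ∨ z - p b ∈ polyline p L := by
  simp only [polyline, mem_iUnion, Finset.mem_range, exists_prop, List.length_cons]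
  constructor
  · rintro ⟨j, hj, hz⟩
    cases j with
    | zero => left; simpa using hz
    | succ j =>
      refine Or.inr ⟨j, by omega, ?_⟩
      rw [← mem_segment_translate ℝ (p b)]
      simpa using hz
  · rintro (hz | ⟨j, hj, hz⟩)
    · exact ⟨0, by omega, by simpa using hz⟩
    · refine ⟨j + 1, by omega, ?_⟩
      rw [← mem_segment_translate ℝ (p b)] at hz
      simpa using hz

theorem mem_segment_zero_iff {a b : ℝ} (ha : 0 < a) (z : ℝ × ℝ) :
    z ∈ segment ℝ 0 (a, b) ↔ (0 ≤ z.1 ∧ z.1 ≤ a) ∧ z.2 = b / a * z.1 := by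
  rw [segment_eq_image']
  simp only [sub_zero, zero_add, mem_image, Prod.smul_mk, smul_eq_mul]
  constructor
  · rintro ⟨t, ⟨h0, h1⟩, rfl⟩
    refine ⟨⟨by positivity, mul_le_of_le_one_left ha.le h1⟩, ?_⟩
    simp only
    field_simp
  · rintro ⟨⟨h0, h1⟩, h2⟩
    refine ⟨z.1 / a, ⟨by positivity, (div_le_one ha).2 h1⟩, Prod.ext ?_ ?_⟩
    · simp only
      field_simp
    · simp only [h2]
      ring

/-- The alternative `z = 0` serves the empty word, whose polyline is empty while the graph over [0,
0] is the origin; with it the induction starts at the empty word. -/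
theorem eq_zero_or_mem_polyline_iff (hh : ∀ b, 0 < h b) (L : List A) (z : ℝ × ℝ) :
    (z = 0 ∨ z ∈ polyline (fun b => (h b, c b)) L) ↔
      z.1 ∈ Icc 0 (L.map h).sum ∧ z.2 = piecewiseLinear h c L z.1 := by
  induction L generalizing z with
  | nil =>
    simp only [polyline, piecewiseLinear, List.map_nil, List.sum_nil, Icc_self, mem_singleton_iff]
    simp [Prod.ext_iff]
  | cons b L ih =>
    have hb := hh b
    have h0 := sum_map_nonneg_of_pos hh L
    have e : (z = 0 ∨ z ∈ polyline (fun b => (h b, c b)) (b :: L)) ↔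
        z ∈ segment ℝ 0 (h b, c b) ∨
          (z - (h b, c b) = 0 ∨ z - (h b, c b) ∈ polyline (fun b => (h b, c b)) L) := by
      rw [mem_polyline_cons]
      constructor
      · rintro (rfl | hz | hz)
        · exact Or.inl (left_mem_segment _ _ _)
        · exact Or.inl hz
        · exact Or.inr (Or.inr hz)
      · rintro (hz | hz | hz)
        · exact Or.inr (Or.inl hz)
        · rw [sub_eq_zero.1 hz]
          exact Or.inr (Or.inl (right_mem_segment _ _ _))
        · exact Or.inr (Or.inr hz)
    rw [e, ih, mem_segment_zero_iff hb]
    simp only [Prod.fst_sub, Prod.snd_sub, mem_Icc, List.map_cons, List.sum_cons, piecewiseLinear]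
    constructor
    · rintro (⟨⟨h1, h2⟩, h3⟩ | ⟨⟨h1, h2⟩, h3⟩)
      · exact ⟨⟨h1, by linarith⟩, by rw [if_pos h2, h3]⟩
      · refine ⟨⟨by linarith, by linarith⟩, ?_⟩
        split_ifs with h4
        · obtain h5 : z.1 = h b := by linarith
          rw [h5, sub_self, piecewiseLinear_zero hh] at h3
          rw [h5, div_mul_cancel₀ _ hb.ne']
          linarith
        · linarith
    · rintro ⟨⟨h1, h2⟩, h3⟩
      split_ifs at h3 with h4
      · exact Or.inl ⟨⟨h1, h4⟩, h3⟩
      · exact Or.inr ⟨⟨by linarith, by linarith⟩, by linarith⟩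

theorem polyline_eq_graph (hh : ∀ b, 0 < h b) {L : List A} (hL : L ≠ []) :
    polyline (fun b => (h b, c b)) L =
      {z | z.1 ∈ Icc 0 (L.map h).sum ∧ z.2 = piecewiseLinear h c L z.1} := by
  ext z
  rw [mem_ofPred_eq, ← eq_zero_or_mem_polyline_iff hh]
  refine ⟨Or.inr, ?_⟩
  rintro (rfl | hz)
  · obtain ⟨b, L', rfl⟩ := List.exists_cons_of_ne_nil hL
    rw [mem_polyline_cons]
    exact Or.inl (left_mem_segment _ _ _)
  · exact hz

end PiecewiseLinear

/-! ### Identification of the limit shapes. -/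

section LimitShape

variable {A : Type*} [Fintype A] [Nontrivial A] [DecidableEq A]

/-- The map `p_ϒ` as a linear map. -/
def pClassₗ (s : PiTau A) (c : RelHomology A) : PuncturedHomology A →ₗ[ℝ] ℝ × ℝ where
  toFun := pClass s c
  map_add' t t' := by
    simp [pClass, pVert, intersection, mul_add, Finset.sum_add_distrib]
  map_smul' r t := by
    simp [pClass, pVert, intersection, Finset.mul_sum, mul_left_comm]

theorem NeverStops.image_brokenLine {s : PiTau A} (h : NeverStops s) (c : RelHomology A) (a : A)
    (n : ℕ) : pClass s c '' brokenLine s a n =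
      {z | z.1 ∈ Icc 0 (s.1.heights s.2 a) ∧
        z.2 = piecewiseLinear (heightsAt s n) (chi s c n) (word s a n) z.1} := by
  have e := image_polyline (pClassₗ s c) (theta s n) (word s a n)
  have e1 : (fun b => pClassₗ s c (theta s n b)) = fun b => (heightsAt s n b, chi s c n b) := by
    ext b
    · exact h.pVert_theta n b
    · rfl
  rw [e1, polyline_eq_graph (h.heightsAt_pos n) (word_ne_nil s a n), h.sum_heightsAt_word] at e
  exact e

theorem NeverStops.limitShape_eq {s : PiTau A} (h : NeverStops s) (c : RelHomology A) (a : A)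
    (n : ℕ) {x : ℝ} (hx : x ∈ Icc 0 (s.1.heights s.2 a)) : limitShape s c a n x =
      piecewiseLinear (heightsAt s n) (chi s c n) (word s a n) x := by
  have hex : ∃ y, (x, y) ∈ pClass s c '' brokenLine s a n := by
    rw [h.image_brokenLine]
    exact ⟨piecewiseLinear (heightsAt s n) (chi s c n) (word s a n) x, hx, rfl⟩
  rw [limitShape, dif_pos hex]
  exact ((h.image_brokenLine c a n).subset hex.choose_spec).2

end LimitShape

/-! ### Integrals of concatenated functions, and averaging of the test function. -/

section BlockSum

variable {A : Type*}

/-- A family of functions attached to words, where the function attached to a word is the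
concatenation of the functions attached to its letters, on intervals of lengths `h b`. -/
structure IsBlockSum (h : A → ℝ) (F : List A → ℝ → ℝ) : Prop where
  continuous : ∀ L, Continuous (F L)
  nil : ∀ x, F [] x = 0
  append_of_le : ∀ L L' x, 0 ≤ x → x ≤ (L.map h).sum → F (L ++ L') x = F L x
  append_of_ge : ∀ L L' x, (L.map h).sum ≤ x → F (L ++ L') x = F L' (x - (L.map h).sum)

namespace IsBlockSum

variable {h : A → ℝ} {F : List A → ℝ → ℝ}

theorem abs_le (H : IsBlockSum h F) {M : ℝ} (hM : 0 ≤ M)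
    (hF : ∀ b x, 0 ≤ x → x ≤ h b → |F [b] x| ≤ M) (L : List A) {x : ℝ} (hx : 0 ≤ x)
    (hx' : x ≤ (L.map h).sum) : |F L x| ≤ M := by
  induction L generalizing x with
  | nil => simpa [H.nil] using hM
  | cons b L ih =>
    rw [← List.singleton_append]
    rcases le_total x (h b) with hb | hb
    · rw [H.append_of_le _ _ _ hx (by simpa using hb)]
      exact hF b x hx hb
    · rw [H.append_of_ge _ _ _ (by simpa using hb)]
      simp only [List.map_cons, List.sum_cons] at hx'
      refine ih ?_ ?_ <;> simp <;> linarith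

theorem integral_append (H : IsBlockSum h F) (hh : ∀ b, 0 < h b) {g : ℝ → ℝ} (hg : Continuous g)
    (L L' : List A) :
    ∫ x in (0 : ℝ)..((L ++ L').map h).sum, g x * F (L ++ L') x =
      (∫ x in (0 : ℝ)..(L.map h).sum, g x * F L x) +
        ∫ x in (0 : ℝ)..(L'.map h).sum, g ((L.map h).sum + x) * F L' x := by
  have hc : Continuous fun x => g x * F (L ++ L') x := hg.mul (H.continuous _)
  have h0 := sum_map_nonneg_of_pos hh L
  have h0' := sum_map_nonneg_of_pos hh L'
  rw [← intervalIntegral.integral_add_adjacent_intervals (b := (L.map h).sum)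
    (hc.intervalIntegrable _ _) (hc.intervalIntegrable _ _)]
  congr 1
  · refine intervalIntegral.integral_congr fun x hx => ?_
    rw [uIcc_of_le h0] at hx
    simp only [H.append_of_le L L' x hx.1 hx.2]
  · rw [List.map_append, List.sum_append]
    have e := intervalIntegral.integral_comp_add_left (a := 0) (b := (L'.map h).sum)
      (fun x => g x * F (L ++ L') x) (L.map h).sum
    rw [add_zero] at e
    rw [← e]
    refine intervalIntegral.integral_congr fun x hx => ?_
    rw [uIcc_of_le h0'] at hx
    rw [H.append_of_ge L L' _ (by linarith [hx.1]), add_sub_cancel_left]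

theorem integral_eq (H : IsBlockSum h F) (hh : ∀ b, 0 < h b) (L : List A) :
    ∫ x in (0 : ℝ)..(L.map h).sum, F L x = (L.map fun b => ∫ x in (0 : ℝ)..h b, F [b] x).sum := by
  induction L with
  | nil => simp
  | cons b L ih =>
    have := H.integral_append hh (continuous_const (y := (1 : ℝ))) [b] L
    simp only [one_mul] at this
    rw [← List.singleton_append, this, ih]
    simp

end IsBlockSum

variable [DecidableEq A]

/-- For each letter, the sum of the averages of `ψ` on the intervals attached to the occurrences of
this letter in a word, when the intervals follow each other from `x₀` on. -/
def averages (h : A → ℝ) (ψ : ℝ → ℝ) : List A → ℝ → A → ℝ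
  | [], _ => 0
  | b :: L, x₀ => Pi.single b ((h b)⁻¹ * ∫ x in x₀..(x₀ + h b), ψ x) + averages h ψ L (x₀ + h b)

/-- Multiplying an average by the length of its block restores the integral over the block. For ψ of
mean zero, the vector of averages is thus orthogonal to the heights, as the spectral gap requires.
-/
theorem sum_mul_averages [Fintype A] {h : A → ℝ} (hh : ∀ b, 0 < h b) {ψ : ℝ → ℝ}
    (hψ : Continuous ψ) (L : List A) (x₀ : ℝ) :
    ∑ b, h b * averages h ψ L x₀ b = ∫ x in x₀..(x₀ + (L.map h).sum), ψ x := by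
  induction L generalizing x₀ with
  | nil => simp [averages]
  | cons b L ih =>
    simp only [averages, Pi.add_apply, mul_add, Finset.sum_add_distrib, ih, List.map_cons,
      List.sum_cons]
    rw [← add_assoc, ← intervalIntegral.integral_add_adjacent_intervals (a := x₀) (b := x₀ + h b)
      (c := x₀ + h b + _) (hψ.intervalIntegrable _ _) (hψ.intervalIntegrable _ _)]
    congr 1
    rw [Finset.sum_eq_single b (fun c _ hc => by simp [hc]) (by simp), Pi.single_eq_same,
      mul_inv_cancel_left₀ (hh b).ne']

theorem abs_averages_le {h : A → ℝ} (hh : ∀ b, 0 < h b) {ψ : ℝ → ℝ} {S : ℝ}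
    (hS : ∀ x, |ψ x| ≤ S) (L : List A) (x₀ : ℝ) (b : A) :
    |averages h ψ L x₀ b| ≤ S * L.length := by
  induction L generalizing x₀ with
  | nil => simp [averages]
  | cons c L ih =>
    simp only [averages, Pi.add_apply, List.length_cons, Nat.cast_add, Nat.cast_one, mul_add,
      mul_one]
    rw [add_comm (S * _)]
    refine (abs_add_le _ _).trans (add_le_add ?_ (ih _))
    rw [Pi.single_apply]
    split_ifs
    · have := intervalIntegral.norm_integral_le_of_norm_le_const (a := x₀) (b := x₀ + h c)
        (f := ψ) (C := S) fun x _ => hS x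
      rw [Real.norm_eq_abs, add_sub_cancel_left, abs_of_pos (hh c)] at this
      rw [abs_mul, abs_of_pos (inv_pos.2 (hh c)), inv_mul_le_iff₀ (hh c), mul_comm (h c)]
      exact this
    · simpa using (abs_nonneg _).trans (hS 0)

theorem abs_sub_average_le {ψ : ℝ → ℝ} (hψ : Continuous ψ) {a K x₀ : ℝ} (ha : 0 < a)
    (hK : ∀ x y, |x - y| ≤ a → |ψ x - ψ y| ≤ K) {y : ℝ} (hy : y ∈ Icc x₀ (x₀ + a)) :
    |ψ y - a⁻¹ * ∫ x in x₀..(x₀ + a), ψ x| ≤ K := by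
  have e : ψ y - a⁻¹ * ∫ x in x₀..(x₀ + a), ψ x = a⁻¹ * ∫ x in x₀..(x₀ + a), (ψ y - ψ x) := by
    rw [intervalIntegral.integral_sub (by simp) (hψ.intervalIntegrable _ _)]
    simp only [intervalIntegral.integral_const, add_sub_cancel_left, smul_eq_mul]
    field_simp
  have h1 := intervalIntegral.norm_integral_le_of_norm_le_const (a := x₀) (b := x₀ + a)
    (f := fun x => ψ y - ψ x) (C := K) fun x hx => by
      rw [uIoc_of_le (by linarith)] at hx
      refine hK y x (abs_le.2 ⟨?_, ?_⟩) <;> linarith [hx.1, hx.2, hy.1, hy.2]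
  rw [Real.norm_eq_abs, add_sub_cancel_left, abs_of_pos ha] at h1
  rw [e, abs_mul, abs_of_pos (inv_pos.2 ha), inv_mul_le_iff₀ ha, mul_comm a]
  exact h1

/-- Comparison of the integral of `ψ` against a concatenation with the integral where `ψ` is
replaced by its averages on coarser intervals. -/
theorem IsBlockSum.abs_integral_sub_le [Fintype A] {h h' : A → ℝ} {F : List A → ℝ → ℝ}
    (H : IsBlockSum h F) (hh : ∀ b, 0 < h b) (hh' : ∀ b, 0 < h' b) {w : A → List A}
    (hw : ∀ b, ((w b).map h).sum = h' b) {M : ℝ} (hM : 0 ≤ M)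
    (hF : ∀ b x, 0 ≤ x → x ≤ h b → |F [b] x| ≤ M) {ψ : ℝ → ℝ} (hψ : Continuous ψ) {K : ℝ}
    (hK : ∀ b x y, |x - y| ≤ h' b → |ψ x - ψ y| ≤ K) (L : List A) (x₀ : ℝ) :
    |(∫ x in (0 : ℝ)..(L.map h').sum, ψ (x₀ + x) * F (L.flatMap w) x) -
      ∑ b, averages h' ψ L x₀ b * ∫ x in (0 : ℝ)..h' b, F (w b) x| ≤ K * M * (L.map h').sum := by
  have hlen : ∀ L : List A, ((L.flatMap w).map h).sum = (L.map h').sum := fun L => by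
    rw [sum_map_flatMap]
    simp only [hw]
  induction L generalizing x₀ with
  | nil => simp [averages]
  | cons b L ih =>
    have hc := H.continuous
    set avg := (h' b)⁻¹ * ∫ x in x₀..(x₀ + h' b), ψ x
    have e := H.integral_append hh (g := fun x => ψ (x₀ + x)) (by fun_prop) (w b) (L.flatMap w)
    rw [List.map_append, List.sum_append, hlen, hw, ← List.flatMap_cons] at e
    simp only [← add_assoc] at e
    have e2 : ∑ c, averages h' ψ (b :: L) x₀ c * ∫ x in (0 : ℝ)..h' c, F (w c) x =
        (∫ x in (0 : ℝ)..h' b, avg * F (w b) x) +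
        ∑ c, averages h' ψ L (x₀ + h' b) c * ∫ x in (0 : ℝ)..h' c, F (w c) x := by
      simp only [averages, Pi.add_apply, add_mul, Finset.sum_add_distrib]
      congr 1
      rw [Finset.sum_eq_single b (fun c _ hc => by simp [hc]) (by simp), Pi.single_eq_same,
        intervalIntegral.integral_const_mul]
    -- On a single coarse block, ψ differs from its average by at most its oscillation K, and the
    -- concatenated function is bounded by M.
    have h1 : |(∫ x in (0 : ℝ)..h' b, ψ (x₀ + x) * F (w b) x) -
        ∫ x in (0 : ℝ)..h' b, avg * F (w b) x| ≤ K * M * h' b := by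
      have i1 : Continuous fun x => ψ (x₀ + x) * F (w b) x := by fun_prop
      have i2 : Continuous fun x => avg * F (w b) x := by fun_prop
      rw [← intervalIntegral.integral_sub (i1.intervalIntegrable _ _) (i2.intervalIntegrable _ _)]
      have := intervalIntegral.norm_integral_le_of_norm_le_const (a := 0) (b := h' b)
        (f := fun x => ψ (x₀ + x) * F (w b) x - avg * F (w b) x) (C := K * M) fun x hx => by
          rw [uIoc_of_le (hh' b).le] at hx
          rw [Real.norm_eq_abs, ← sub_mul, abs_mul]
          have h2 := abs_sub_average_le hψ (hh' b) (hK b) (x₀ := x₀) (y := x₀ + x)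
            ⟨by linarith [hx.1], by linarith [hx.2]⟩
          exact mul_le_mul h2 (H.abs_le hM hF _ hx.1.le (by rw [hw]; exact hx.2)) (abs_nonneg _)
            ((abs_nonneg _).trans h2)
      simpa [abs_of_pos (hh' b)] using this
    rw [List.map_cons, List.sum_cons, e, e2, add_sub_add_comm, mul_add]
    exact (abs_add_le _ _).trans (add_le_add h1 (ih _))

end BlockSum

/-! ### The increment between consecutive limit shapes. -/

section Refinement

variable {A : Type*} [Fintype A] [Nontrivial A] [DecidableEq A]

/-- The increment between the limit shapes at times `-n` and `-n - 1`. -/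
def increment (s : PiTau A) (c : RelHomology A) (n : ℕ) (L : List A) (x : ℝ) : ℝ :=
  piecewiseLinear (heightsAt s (n + 1)) (chi s c (n + 1))
      (L.flatMap (substLetter (backIter s n))) x
    - piecewiseLinear (heightsAt s n) (chi s c n) L x

variable {s : PiTau A}

theorem NeverStops.sum_heightsAt_succ_flatMap (h : NeverStops s) (n : ℕ) (L : List A) :
    ((L.flatMap (substLetter (RauzyVeech.backIter s n))).map (heightsAt s (n + 1))).sum =
      (L.map (heightsAt s n)).sum := by
  rw [sum_map_flatMap, h.heightsAt_succ]
  simp only [sum_map_substLetter (h.winner_ne_loser n)]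

theorem NeverStops.sum_chi_succ_flatMap (h : NeverStops s) (c : RelHomology A) (n : ℕ)
    (L : List A) :
    ((L.flatMap (substLetter (RauzyVeech.backIter s n))).map (chi s c (n + 1))).sum =
      (L.map (chi s c n)).sum := by
  rw [sum_map_flatMap, chi_succ]
  simp only [sum_map_substLetter (h.winner_ne_loser n)]

/-- The substitution preserves the horizontal and vertical displacement of every word, so the old
and new shapes have the same value at the end of each block; these values cancel in the difference,
which therefore restarts at 0. -/
theorem NeverStops.isBlockSum_increment (h : NeverStops s) (c : RelHomology A) (n : ℕ) :
    IsBlockSum (heightsAt s n) (increment s c n) where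
  continuous L := (continuous_piecewiseLinear (h.heightsAt_pos _) _).sub
    (continuous_piecewiseLinear (h.heightsAt_pos _) _)
  nil x := by simp [increment, piecewiseLinear]
  append_of_le L L' x hx hx' := by
    unfold increment
    rw [List.flatMap_append, piecewiseLinear_append_of_le (h.heightsAt_pos _) _ _ hx
      (by rwa [h.sum_heightsAt_succ_flatMap]),
      piecewiseLinear_append_of_le (h.heightsAt_pos _) _ _ hx hx']
  append_of_ge L L' x hx := by
    unfold increment
    rw [List.flatMap_append, piecewiseLinear_append_of_ge (h.heightsAt_pos _) _ _
      (by rwa [h.sum_heightsAt_succ_flatMap]),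
      piecewiseLinear_append_of_ge (h.heightsAt_pos _) _ _ hx,
      h.sum_heightsAt_succ_flatMap, h.sum_chi_succ_flatMap]
    ring

theorem NeverStops.increment_of_ne_loser (h : NeverStops s) (c : RelHomology A) (n : ℕ) {b : A}
    (hb : b ≠ loser (RauzyVeech.backIter s n)) {x : ℝ} (hx : x ≤ heightsAt s n b) :
    increment s c n [b] x = 0 := by
  have e1 : heightsAt s (n + 1) b = heightsAt s n b := by simp [h.heightsAt_succ, hb]
  have e2 : chi s c (n + 1) b = chi s c n b := by simp [chi_succ, hb]
  simp [increment, substLetter, hb, piecewiseLinear, e1, e2, hx]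

theorem NeverStops.abs_increment_singleton_le (h : NeverStops s) (c : RelHomology A) (n : ℕ)
    (b : A) {x : ℝ} (hx : 0 ≤ x) :
    |increment s c n [b] x| ≤ 2 * ‖chi s c (n + 1)‖ + ‖chi s c n‖ := by
  have h1 := abs_piecewiseLinear_le (c := chi s c (n + 1)) (h.heightsAt_pos (n + 1))
    ([b].flatMap (substLetter (RauzyVeech.backIter s n))) hx
  have h2 := abs_piecewiseLinear_le (c := chi s c n) (h.heightsAt_pos n) [b] hx
  have h3 : ∀ n b, |chi s c n b| ≤ ‖chi s c n‖ := fun n b => norm_le_pi_norm (chi s c n) b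
  refine (abs_sub _ _).trans (add_le_add (h1.trans ?_) (h2.trans (by simpa using h3 n b)))
  have h4 := norm_nonneg (chi s c (n + 1))
  simp only [List.flatMap_cons, List.flatMap_nil, List.append_nil]
  unfold substLetter
  split_ifs <;> simp only [List.map_cons, List.map_nil, List.sum_cons, List.sum_nil] <;>
    linarith [h3 (n + 1) b, h3 (n + 1) (loser (RauzyVeech.backIter s n)),
      h3 (n + 1) (winner (RauzyVeech.backIter s n))]

/-- The integral of the increment over the interval of a letter `b` at time `-m`. -/
theorem NeverStops.integral_increment_word (h : NeverStops s) (c : RelHomology A) (m k : ℕ)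
    (b : A) :
    ∫ x in (0 : ℝ)..heightsAt s m b,
        increment s c (m + k) (word (RauzyVeech.backIter s m) b k) x =
      kz (RauzyVeech.backIter s m) k b (loser (RauzyVeech.backIter s (m + k))) *
        ∫ x in (0 : ℝ)..heightsAt s (m + k) (loser (RauzyVeech.backIter s (m + k))),
          increment s c (m + k) [loser (RauzyVeech.backIter s (m + k))] x := by
  have h1 := (h.backIter m).sum_heightsAt_word b k
  have h2 : heightsAt (RauzyVeech.backIter s m) k = heightsAt s (m + k) := heightsAt_backIter s m k
  rw [h2] at h1
  change _ = heightsAt s m b at h1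
  -- Only the occurrences of the loser contribute, each with the same integral, and their number is
  -- a matrix entry.
  rw [← h1, (h.isBlockSum_increment c (m + k)).integral_eq (h.heightsAt_pos _),
    sum_map_eq_sum_count, Finset.sum_eq_single (loser (RauzyVeech.backIter s (m + k)))]
  · rw [(h.backIter m).count_word]
  · intro a _ ha
    rw [mul_eq_zero]
    right
    refine intervalIntegral.integral_zero_ae (Eventually.of_forall fun x hx => ?_)
    rw [uIoc_of_le (h.heightsAt_pos _ _).le] at hx
    exact h.increment_of_ne_loser c _ ha hx.2
  · simp

end Refinement

/-! ### The spectral gap and the key estimate on increments. -/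

section SpectralGap

variable {A : Type*} [Fintype A] [Nontrivial A] [DecidableEq A] {s : PiTau A}

/-- The spectral gap condition, from an arbitrary time `-m` on. -/
theorem NeverStops.norm_kz_transpose_mulVec_le (h : NeverStops s) {θ C₁ : ℝ} (hC₁ : 0 < C₁)
    (hgap : ∀ n : ℕ, ∀ v : A → ℝ, ∑ a, s.1.heights s.2 a * v a = 0 →
      ‖(kz s n)ᵀ *ᵥ v‖ ≤ C₁ * matNorm (kz s n)ᵀ ^ (1 - θ) * ‖v‖) (m k : ℕ) {v : A → ℝ}
    (hv : ∑ a, heightsAt s m a * v a = 0) :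
    ‖(kz (RauzyVeech.backIter s m) k)ᵀ *ᵥ v‖ ≤ C₁ * matNorm (kz s (m + k)) ^ (1 - θ) *
      (Fintype.card A * ((Fintype.card A).factorial * matNorm (kz s m) ^ Fintype.card A) *
        ‖v‖) := by
  have hdet : (kz s m)ᵀ.det = 1 := by rw [Matrix.det_transpose, h.det_kz]
  -- The gap is assumed for vectors at time 0, so `v` is pulled back there. The identity q = B
  -- q^(-m) keeps `v'` in the orthogonal hyperplane, and Cramer's rule bounds its norm polynomially
  -- in the norm of B(-m, 0).
  set v' := ((kz s m)ᵀ)⁻¹ *ᵥ v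
  have hv' : (kz s m)ᵀ *ᵥ v' = v := by
    rw [Matrix.mulVec_mulVec, Matrix.mul_nonsing_inv _ (by simp [hdet]), Matrix.one_mulVec]
  have horth : ∑ a, s.1.heights s.2 a * v' a = 0 := by
    change s.1.heights s.2 ⬝ᵥ v' = 0
    rw [← h.kz_mulVec_heightsAt m, ← Matrix.vecMul_transpose, ← Matrix.dotProduct_mulVec, hv']
    exact hv
  have hnorm : ‖v'‖ ≤ Fintype.card A *
      ((Fintype.card A).factorial * matNorm (kz s m) ^ Fintype.card A) * ‖v‖ := by
    have h0 := matNorm_nonneg (kz s m)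
    refine (pi_norm_le_iff_of_nonneg (by positivity)).2 fun a => ?_
    refine (Finset.abs_sum_le_sum_abs _ _).trans ?_
    refine (Finset.sum_le_card_nsmul _ _
      ((Fintype.card A).factorial * matNorm (kz s m) ^ Fintype.card A * ‖v‖) fun b _ => ?_).trans_eq
      (by rw [nsmul_eq_mul, Finset.card_univ]; ring)
    rw [abs_mul]
    refine mul_le_mul ?_ (norm_le_pi_norm v b) (abs_nonneg _) (by positivity)
    have := abs_inv_apply_le hdet (by rw [matNorm_transpose]; exact one_le_matNorm_kz s m) a b
    rwa [matNorm_transpose] at this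
  have e : (kz (RauzyVeech.backIter s m) k)ᵀ *ᵥ v = (kz s (m + k))ᵀ *ᵥ v' := by
    rw [kz_add, Matrix.transpose_mul, ← Matrix.mulVec_mulVec, hv']
  rw [e]
  refine (hgap _ v' horth).trans ?_
  rw [matNorm_transpose]
  have h0 := matNorm_nonneg (kz s (m + k))
  gcongr

/-- The first term is the error made in averaging ψ over the blocks at time -m. The second is the
spectral gap bound for the averages, whose norm is at most S times the length of the word at time
-m, multiplied by a bound for the integral of the bump over one loser block. -/
theorem NeverStops.abs_integral_increment_le (h : NeverStops s) {θ C₁ : ℝ} (hC₁ : 0 < C₁)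
    (hgap : ∀ n : ℕ, ∀ v : A → ℝ, ∑ a, s.1.heights s.2 a * v a = 0 →
      ‖(kz s n)ᵀ *ᵥ v‖ ≤ C₁ * matNorm (kz s n)ᵀ ^ (1 - θ) * ‖v‖) (c : RelHomology A) (a : A)
    {ψ : ℝ → ℝ} (hψ : Continuous ψ) {S : ℝ} (hS : ∀ x, |ψ x| ≤ S)
    (hψ0 : ∫ x in (0 : ℝ)..s.1.heights s.2 a, ψ x = 0) {m n : ℕ} (hmn : m ≤ n) {K M : ℝ}
    (hK : ∀ b x y, |x - y| ≤ heightsAt s m b → |ψ x - ψ y| ≤ K)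
    (hM : 2 * ‖chi s c (n + 1)‖ + ‖chi s c n‖ ≤ M) :
    |∫ x in (0 : ℝ)..s.1.heights s.2 a, ψ x * increment s c n (word s a n) x| ≤
      K * M * s.1.heights s.2 a + C₁ * matNorm (kz s n) ^ (1 - θ) *
        (Fintype.card A * ((Fintype.card A).factorial * matNorm (kz s m) ^ Fintype.card A) *
          (S * matNorm (kz s m))) *
        (M * heightsAt s n (loser (RauzyVeech.backIter s n))) := by
  obtain ⟨k, rfl⟩ := Nat.exists_eq_add_of_le hmn
  have hM0 : 0 ≤ M := le_trans (by positivity) hM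
  have hS0 : 0 ≤ S := (abs_nonneg _).trans (hS 0)
  set ℓ := loser (RauzyVeech.backIter s (m + k))
  have hF : ∀ b x, 0 ≤ x → x ≤ heightsAt s (m + k) b → |increment s c (m + k) [b] x| ≤ M :=
    fun b x hx _ => (h.abs_increment_singleton_le c _ b hx).trans hM
  have hw : ∀ b, ((word (RauzyVeech.backIter s m) b k).map (heightsAt s (m + k))).sum =
      heightsAt s m b := fun b => by
    have := (h.backIter m).sum_heightsAt_word b k
    rwa [show heightsAt (RauzyVeech.backIter s m) k = heightsAt s (m + k) from
      heightsAt_backIter s m k] at this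
  have key := (h.isBlockSum_increment c (m + k)).abs_integral_sub_le (h.heightsAt_pos _)
    (h.heightsAt_pos m) hw hM0 hF hψ hK (word s a m) 0
  set v := averages (heightsAt s m) ψ (word s a m) 0
  have hlen := h.sum_heightsAt_word a m
  -- Each block contributes its average times a matrix entry times the common integral `T` of the
  -- bump, so the averaged integral becomes a coordinate of a transposed matrix applied to `v`.
  simp only [zero_add, hlen, ← word_add, h.integral_increment_word] at key
  set T := ∫ x in (0 : ℝ)..heightsAt s (m + k) ℓ, increment s c (m + k) [ℓ] x
  have hT : |T| ≤ M * heightsAt s (m + k) ℓ := by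
    have hp := h.heightsAt_pos (m + k) ℓ
    have := intervalIntegral.norm_integral_le_of_norm_le_const (a := 0)
      (b := heightsAt s (m + k) ℓ) (f := increment s c (m + k) [ℓ]) (C := M) fun x hx => by
        rw [uIoc_of_le hp.le] at hx
        exact hF ℓ x hx.1.le hx.2
    rwa [sub_zero, abs_of_pos hp] at this
  have hv : ∑ b, heightsAt s m b * v b = 0 := by
    rw [sum_mul_averages (h.heightsAt_pos m) hψ, hlen, zero_add, hψ0]
  have hvn : ‖v‖ ≤ S * matNorm (kz s m) := by
    have := matNorm_nonneg (kz s m)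
    refine (pi_norm_le_iff_of_nonneg (by positivity)).2 fun b => ?_
    refine (abs_averages_le (h.heightsAt_pos m) hS (word s a m) 0 b).trans ?_
    exact mul_le_mul_of_nonneg_left (h.length_word_le a m) hS0
  have e : ∑ b, v b * (kz (RauzyVeech.backIter s m) k b ℓ * T) =
      ((kz (RauzyVeech.backIter s m) k)ᵀ *ᵥ v) ℓ * T := by
    simp only [Matrix.mulVec, dotProduct, Matrix.transpose_apply, Finset.sum_mul]
    exact Finset.sum_congr rfl fun b _ => by ring
  rw [e] at key
  have h1 : |((kz (RauzyVeech.backIter s m) k)ᵀ *ᵥ v) ℓ| ≤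
      C₁ * matNorm (kz s (m + k)) ^ (1 - θ) *
        (Fintype.card A * ((Fintype.card A).factorial * matNorm (kz s m) ^ Fintype.card A) *
          (S * matNorm (kz s m))) := by
    refine (norm_le_pi_norm _ ℓ).trans
      ((h.norm_kz_transpose_mulVec_le hC₁ hgap m k hv).trans ?_)
    have h0 := matNorm_nonneg (kz s (m + k))
    have h0' := matNorm_nonneg (kz s m)
    gcongr
  have h2 := mul_le_mul h1 hT (abs_nonneg _) ((abs_nonneg _).trans h1)
  rw [← abs_mul] at h2
  have h3 := abs_sub_abs_le_abs_sub (∫ x in (0 : ℝ)..s.1.heights s.2 a,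
    ψ x * increment s c (m + k) (word s a (m + k)) x)
    (((kz (RauzyVeech.backIter s m) k)ᵀ *ᵥ v) ℓ * T)
  linarith

/-- An intermediate time, at which the matrix has size comparable to the power `κ` of the size
of the matrix at time `-n`. -/
theorem exists_matNorm_kz_between {κ : ℝ} (hκ : κ < 1) {n : ℕ}
    (hn : Fintype.card A ≤ matNorm (kz s n) ^ κ) : ∃ m ≤ n,
      matNorm (kz s m) ≤ matNorm (kz s n) ^ κ ∧ matNorm (kz s n) ^ κ / 2 ≤ matNorm (kz s m) := by
  classical
  set P : ℕ → Prop := fun m => matNorm (kz s m) ≤ matNorm (kz s n) ^ κ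
  have h0 : P 0 := by simpa only [P, matNorm_kz_zero] using hn
  have hspec := Nat.findGreatest_spec (P := P) (Nat.zero_le n) h0
  have hle := Nat.findGreatest_le (P := P) n
  have hn1 : matNorm (kz s n) ^ κ < matNorm (kz s n) := by
    have := Real.rpow_lt_rpow_of_exponent_lt
      (one_lt_two.trans_le (two_le_matNorm_kz s n)) hκ
    rwa [Real.rpow_one] at this
  refine ⟨Nat.findGreatest P n, hle, hspec, ?_⟩
  have hlt : Nat.findGreatest P n < n := by
    refine lt_of_le_of_ne hle fun e => ?_
    rw [e] at hspec
    exact hn1.not_ge hspec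
  -- The next time already exceeds the threshold, and one step at most doubles the norm: hence the
  -- lower bound with the factor 1/2.
  have := Nat.findGreatest_is_greatest (P := P) (Nat.lt_succ_self _) hlt
  have h2 := matNorm_kz_succ_le s (Nat.findGreatest P n)
  have h3 := not_le.1 this
  simp only [Nat.succ_eq_add_one] at h3
  linarith

end SpectralGap

/-! ### Subpolynomial growth of the coordinates of the class. -/

section Growth

variable {A : Type*} [Fintype A] [Nontrivial A] [DecidableEq A]

theorem ZipData.IsSubpolynomial.eventually_norm_chi_le {M : ZipData A} {c : RelHomology A}
    (h : M.IsSubpolynomial c) {ε : ℝ} (hε : 0 < ε) : ∀ᶠ n in atTop,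
      ‖chi M.piTau c n‖ ≤ ‖c‖ * matNorm (kz M.piTau n) ^ ε := by
  have h1 : limsup (fun n : ℕ => ((Real.log (‖chi M.piTau c n‖ / ‖chi M.piTau c 0‖) /
    Real.log (matNorm (kz M.piTau n)) : ℝ) : EReal)) atTop < (ε : EReal) :=
    lt_of_le_of_lt h (by exact_mod_cast hε)
  filter_upwards [eventually_lt_of_limsup_lt h1] with n hn
  have hN := two_le_matNorm_kz M.piTau n
  rw [EReal.coe_lt_coe_iff, chi_zero, div_lt_iff₀ (Real.log_pos (by linarith))] at hn
  rcases eq_or_ne c 0 with rfl | hc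
  · have : chi M.piTau 0 n = 0 := by simpa using chi_smul M.piTau 0 0 n
    simp [this]
  · have hc' : 0 < ‖c‖ := norm_pos_iff.2 hc
    -- The value 0 is treated apart, since `Real.log 0 = 0` makes the logarithmic inequality
    -- uninformative there.
    rcases (norm_nonneg (chi M.piTau c n)).eq_or_lt with h0 | h0
    · rw [← h0]
      positivity
    · rw [← div_le_iff₀' hc', ← Real.log_le_log_iff (by positivity) (by positivity),
        Real.log_rpow (by linarith)]
      exact hn.le

/-- A bound for the size of the increments of the limit shapes. -/
theorem ZipData.IsSubpolynomial.eventually_chi_le {M : ZipData A} {c : RelHomology A}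
    (h : M.IsSubpolynomial c) {ε : ℝ} (hε : 0 < ε) (hε1 : ε ≤ 1) : ∀ᶠ n in atTop,
      2 * ‖chi M.piTau c (n + 1)‖ + ‖chi M.piTau c n‖ ≤
        5 * ‖c‖ * matNorm (kz M.piTau n) ^ ε := by
  have h1 := h.eventually_norm_chi_le hε
  filter_upwards [h1, (tendsto_add_atTop_nat 1).eventually h1] with n hn hn1
  have h0 := matNorm_nonneg (kz M.piTau n)
  -- Passing to time -n-1 costs a factor 2^ε ≤ 2, which gives the constant 5 = 2 · 2 + 1.
  have h2 : matNorm (kz M.piTau (n + 1)) ^ ε ≤ 2 * matNorm (kz M.piTau n) ^ ε := by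
    refine (Real.rpow_le_rpow (matNorm_nonneg _) (matNorm_kz_succ_le _ n) hε.le).trans ?_
    rw [Real.mul_rpow zero_le_two h0]
    gcongr
    simpa using Real.rpow_le_rpow_of_exponent_le one_le_two hε1
  have := mul_le_mul_of_nonneg_left h2 (norm_nonneg c)
  linarith

end Growth

/-! ### Choice of exponents and decay of the increments. -/

section Convergence

variable {A : Type*} [Fintype A] [Nontrivial A] [DecidableEq A]

/-- Composing with the projection onto the interval, which is 1-Lipschitz, extends ψ by constants
with the same Hölder bound; the averaging estimates use a function on the whole line. -/
theorem exists_holder_extension {q : ℝ} (hq : 0 ≤ q) {C η : ℝ≥0} (hη : 0 < η) {ψ : ℝ → ℝ}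
    (h : HolderOnWith C η ψ (Icc 0 q)) : ∃ φ : ℝ → ℝ, EqOn φ ψ (Icc 0 q) ∧ Continuous φ ∧
      (∃ S, ∀ x, |φ x| ≤ S) ∧ ∀ x y, |φ x - φ y| ≤ C * |x - y| ^ (η : ℝ) := by
  have hc : ContinuousOn ψ (Icc 0 q) := h.continuousOn hη
  obtain ⟨S, hS⟩ := isCompact_Icc.exists_bound_of_continuousOn hc
  refine ⟨fun x => ψ (projIcc 0 q hq x), fun x hx => ?_, ?_,
    ⟨S, fun x => hS _ (projIcc 0 q hq x).2⟩,
    fun x y => ?_⟩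
  · simp [projIcc_of_mem hq hx]
  · exact hc.comp_continuous (continuous_subtype_val.comp continuous_projIcc) fun x =>
      (projIcc 0 q hq x).2
  · have h1 := h.dist_le (projIcc 0 q hq x).2 (projIcc 0 q hq y).2
    rw [Real.dist_eq, Real.dist_eq] at h1
    exact h1.trans (mul_le_mul_of_nonneg_left (Real.rpow_le_rpow (abs_nonneg _)
      (abs_projIcc_sub_projIcc hq) η.2) C.2)

theorem exists_exponent {θ : ℝ} (hθ : 0 < θ) (D : ℕ) :
    ∃ κ : ℝ, 0 < κ ∧ κ < 1 ∧ κ ≤ θ ∧ κ * (D + 1) ≤ θ / 4 := by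
  have hD : (0 : ℝ) < D + 1 := by positivity
  have hmin : 0 < min θ 1 := lt_min hθ one_pos
  refine ⟨min θ 1 / (4 * (D + 1)), by positivity, ?_, ?_, ?_⟩
  · rw [div_lt_iff₀ (by positivity)]
    linarith [min_le_right θ 1]
  · rw [div_le_iff₀ (by positivity)]
    nlinarith [min_le_left θ 1]
  · rw [div_mul_eq_mul_div, mul_div_mul_right _ _ hD.ne']
    linarith [min_le_left θ 1]

/-- The exponents add up to (1 - θ) + θ/4 + ε + (-1 + ε) = 2ε - 3θ/4, which is at most -ε. The term
θ/4 is the price N'^(D+1) of working from the intermediate time. -/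
theorem main_term_le {N N' S C₁ H X y θ κ ε : ℝ} {D : ℕ} (hN : 2 ≤ N) (hN'0 : 0 < N')
    (hS0 : 0 ≤ S) (hC₁ : 0 ≤ C₁) (hH : 0 ≤ H) (hX : 0 ≤ X) (hκ : κ * (D + 1) ≤ θ / 4)
    (hε : 3 * ε ≤ 3 * θ / 4) (hm : N' ≤ N ^ κ) (hy0 : 0 ≤ y)
    (hy : y ≤ H * N ^ (-1 + ε)) :
    C₁ * N ^ (1 - θ) * (D * (D.factorial * N' ^ D) * (S * N')) * (5 * X * N ^ ε * y) ≤
      C₁ * (D * D.factorial * S) * (5 * X * H) * N ^ (-ε) := by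
  have hN0 : 0 < N := by linarith
  have h1 : N' ^ (D + 1) ≤ N ^ (θ / 4) := by
    calc N' ^ (D + 1) ≤ (N ^ κ) ^ (D + 1) := pow_le_pow_left₀ hN'0.le hm _
      _ = N ^ (κ * (D + 1)) := by
        rw [← Real.rpow_natCast, ← Real.rpow_mul hN0.le]
        push_cast
        rfl
      _ ≤ N ^ (θ / 4) := Real.rpow_le_rpow_of_exponent_le (by linarith) (by linarith)
  have h2 : N ^ (1 - θ) * N ^ (θ / 4) * N ^ ε * N ^ (-1 + ε) ≤ N ^ (-ε) := by
    rw [← Real.rpow_add hN0, ← Real.rpow_add hN0, ← Real.rpow_add hN0]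
    exact Real.rpow_le_rpow_of_exponent_le (by linarith) (by linarith)
  calc C₁ * N ^ (1 - θ) * (D * (D.factorial * N' ^ D) * (S * N')) * (5 * X * N ^ ε * y)
      = C₁ * (D * D.factorial * S) * (5 * X) * (N ^ (1 - θ) * N' ^ (D + 1) * N ^ ε * y) := by ring
    _ ≤ C₁ * (D * D.factorial * S) * (5 * X) * (N ^ (1 - θ) * N ^ (θ / 4) * N ^ ε *
        (H * N ^ (-1 + ε))) := by
      gcongr
    _ = C₁ * (D * D.factorial * S) * (5 * X * H) *
        (N ^ (1 - θ) * N ^ (θ / 4) * N ^ ε * N ^ (-1 + ε)) := by ring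
    _ ≤ _ := by gcongr

theorem IsDualRothType.exists_eventually_abs_integral_increment_le {s : PiTau A}
    (hs : s.1.IsSuspension s.2) (hR : IsDualRothType s)
    (hsum : ∀ t : ℝ, 0 < t → Summable fun n : ℕ => matNorm (kz s n) ^ (-t))
    {c : RelHomology A} (hc : ∀ ε : ℝ, 0 < ε → ε ≤ 1 → ∀ᶠ n in atTop,
      2 * ‖chi s c (n + 1)‖ + ‖chi s c n‖ ≤ 5 * ‖c‖ * matNorm (kz s n) ^ ε)
    (a : A) {ψ : ℝ → ℝ} (hψ : Continuous ψ) {S : ℝ} (hS : ∀ x, |ψ x| ≤ S) {C η : ℝ} (hC : 0 ≤ C)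
    (hη : 0 < η) (hη1 : η ≤ 1) (hψη : ∀ x y, |ψ x - ψ y| ≤ C * |x - y| ^ η)
    (hψ0 : ∫ x in (0 : ℝ)..s.1.heights s.2 a, ψ x = 0) : ∃ t : ℝ, 0 < t ∧ ∃ B : ℝ,
      ∀ᶠ n in atTop, |∫ x in (0 : ℝ)..s.1.heights s.2 a, ψ x * increment s c n (word s a n) x| ≤
        B * matNorm (kz s n) ^ (-t) := by
  have h : NeverStops s := ⟨hs, hR.rotation⟩
  obtain ⟨θ, hθ, C₁, hC₁, hgap⟩ := hR.gap
  obtain ⟨κ, hκ, hκ1, hκθ, hκD⟩ := exists_exponent hθ (Fintype.card A)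
  -- The heights at time -m are O(N^(-κ/2)), so ψ oscillates by O(N^(-κη/2)) = O(N^(-2ε)) on a
  -- block; after the factor N^ε of the coordinates χ, the decay N^(-ε) is left.
  obtain ⟨ε, hε_def⟩ : ∃ ε, ε = κ * η / 4 := ⟨_, rfl⟩
  have hε : 0 < ε := by rw [hε_def]; positivity
  have hεκ : ε ≤ κ / 4 := by
    have := mul_le_of_le_one_right hκ.le hη1
    linarith
  obtain ⟨H₁, hH₁, hH₁'⟩ := hR.heightsAt_le hs (ε := 1 / 2) (by norm_num)
  obtain ⟨H₂, hH₂, hH₂'⟩ := hR.heightsAt_le hs hε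
  have hS0 : 0 ≤ S := (abs_nonneg _).trans (hS 0)
  refine ⟨ε, hε, C * (H₁ * (1 / 2) ^ (-(1 / 2) : ℝ)) ^ η * (5 * ‖c‖) * s.1.heights s.2 a +
    C₁ * (Fintype.card A * (Fintype.card A).factorial * S) * (5 * ‖c‖ * H₂), ?_⟩
  have hlarge : ∀ᶠ n in atTop, (Fintype.card A : ℝ) ≤ matNorm (kz s n) ^ κ := by
    filter_upwards [(hsum κ hκ).tendsto_atTop_zero.eventually_lt_const
      (show (0 : ℝ) < (Fintype.card A : ℝ)⁻¹ by positivity)] with n hn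
    rw [Real.rpow_neg (matNorm_nonneg _)] at hn
    have hN := two_le_matNorm_kz s n
    exact ((inv_lt_inv₀ (by positivity) (by positivity)).1 hn).le
  filter_upwards [hlarge, hc ε hε (by linarith)] with n hn hχ
  obtain ⟨m, hmn, hm, hm'⟩ := exists_matNorm_kz_between hκ1 hn
  set N := matNorm (kz s n)
  set N' := matNorm (kz s m)
  have hN : 2 ≤ N := two_le_matNorm_kz _ _
  have hN0 : 0 < N := by linarith
  have hN' : 2 ≤ N' := two_le_matNorm_kz _ _
  have hN'0 : 0 < N' := by linarith
  set K : ℝ := C * (H₁ * (1 / 2) ^ (-(1 / 2) : ℝ)) ^ η * N ^ (-(2 * ε))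
  have hK : ∀ b x y, |x - y| ≤ heightsAt s m b → |ψ x - ψ y| ≤ K := by
    intro b x y hxy
    refine (hψη x y).trans ?_
    -- The exponent -1/2 reverses inequalities, so the lower bound N^κ / 2 ≤ N' is the one needed;
    -- it produces the factor (1/2)^(-1/2).
    have h1 : |x - y| ≤ H₁ * (1 / 2) ^ (-(1 / 2) : ℝ) * N ^ (κ * (-(1 / 2))) := by
      refine hxy.trans ((hH₁' m b).trans ?_)
      rw [mul_assoc]
      refine mul_le_mul_of_nonneg_left ?_ hH₁.le
      rw [Real.rpow_mul hN0.le, ← Real.mul_rpow (by norm_num) (by positivity),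
        show (-1 + 1 / 2 : ℝ) = -(1 / 2) by norm_num]
      refine Real.rpow_le_rpow_of_nonpos (by positivity) ?_ (by norm_num)
      linarith
    have h2 := Real.rpow_le_rpow (abs_nonneg _) h1 hη.le
    rw [Real.mul_rpow (by positivity) (by positivity), ← Real.rpow_mul hN0.le,
      show κ * (-(1 / 2)) * η = -(2 * ε) by rw [hε_def]; ring] at h2
    simp only [K]
    rw [mul_assoc C]
    exact mul_le_mul_of_nonneg_left h2 hC
  refine (h.abs_integral_increment_le hC₁ hgap c a hψ hS hψ0 hmn hK hχ).trans ?_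
  rw [add_mul]
  refine add_le_add (le_of_eq ?_) ?_
  · rw [show -ε = -(2 * ε) + ε by ring, Real.rpow_add hN0]
    simp only [K]
    ring
  · exact main_term_le hN hN'0 hS0 hC₁.le hH₂.le (norm_nonneg c) (by linarith) (by linarith) hm
      (h.heightsAt_pos n _).le (hH₂' n _)

end Convergence

end RauzyVeech

end

theorem proposition6p9 {A : Type*} [Fintype A] [DecidableEq A] [Nontrivial A]
    (M : ZipData A) (hM : M.IsNegKZHyperbolic) (hR : IsDualRothType M.piTau)
    (υ : M.comb.Marked → ℝ) (hυ : ∑ᶠ C, υ C = 0)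
    (ϒ : RelHomology A) (hboundary : M.comb.boundary ϒ = υ) (hϒ : M.IsSubpolynomial ϒ)
    (α : A) :
    (∀ n : ℕ, pClass M.piTau ϒ '' brokenLine M.piTau α n =
      {z : ℝ × ℝ | z.1 ∈ Set.Icc 0 (M.q α) ∧ z.2 = limitShape M.piTau ϒ α n z.1}) ∧
    ∀ (η : ℝ≥0), 0 < η → η < 1 → ∀ ψ : ℝ → ℝ,
      (∃ C : ℝ≥0, HolderOnWith C η ψ (Set.Icc 0 (M.q α))) →
      ∫ x in (0 : ℝ)..(M.q α), ψ x = 0 →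
      (∀ n : ℕ, IntervalIntegrable (fun x => ψ x * limitShape M.piTau ϒ α n x)
        MeasureTheory.volume 0 (M.q α)) ∧
      ∃ l : ℝ, Tendsto
        (fun n : ℕ => ∫ x in (0 : ℝ)..(M.q α), ψ x * limitShape M.piTau ϒ α n x) atTop (𝓝 l) := by
  have h : NeverStops M.piTau := ⟨M.suspension, hR.rotation⟩
  have hq : 0 < M.q α := CombData.IsSuspension.heights_pos M.suspension α
  set F : ℕ → ℝ → ℝ := fun n => piecewiseLinear (heightsAt M.piTau n) (chi M.piTau ϒ n)
    (word M.piTau α n)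
  have hF : ∀ n, Continuous (F n) := fun n => continuous_piecewiseLinear (h.heightsAt_pos n) _
  have hlim : ∀ n, ∀ x ∈ Icc 0 (M.q α), limitShape M.piTau ϒ α n x = F n x :=
    fun n x hx => h.limitShape_eq ϒ α n hx
  refine ⟨fun n => ?_, ?_⟩
  · rw [h.image_brokenLine]
    ext z
    refine and_congr_right fun hz => ?_
    rw [hlim n z.1 hz]
  rintro η hη hη1 ψ ⟨C, hC⟩ hψ0
  obtain ⟨φ, hφψ, hφ, ⟨S, hS⟩, hφη⟩ := exists_holder_extension hq.le hη hC
  have heq : ∀ n, ∀ x ∈ uIoc 0 (M.q α), φ x * F n x = ψ x * limitShape M.piTau ϒ α n x := by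
    intro n x hx
    rw [uIoc_of_le hq.le] at hx
    rw [hφψ ⟨hx.1.le, hx.2⟩, hlim n x ⟨hx.1.le, hx.2⟩]
  have hint : ∀ n, IntervalIntegrable (fun x => φ x * F n x) MeasureTheory.volume 0 (M.q α) :=
    fun n => (hφ.mul (hF n)).intervalIntegrable _ _
  refine ⟨fun n => (hint n).congr (heq n), ?_⟩
  have hφ0 : ∫ x in (0 : ℝ)..(M.q α), φ x = 0 := by
    refine (intervalIntegral.integral_congr fun x hx => hφψ ?_).trans hψ0
    rwa [uIcc_of_le hq.le] at hx
  obtain ⟨t, ht, B, hB⟩ := hR.exists_eventually_abs_integral_increment_le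
    M.suspension hM.summable (fun ε => hϒ.eventually_chi_le) α hφ hS C.2
    (NNReal.coe_pos.2 hη) (by exact_mod_cast hη1.le) hφη hφ0
  -- `F (n + 1) - F n` is by definition the increment of the word at time -n, so consecutive
  -- integrals differ by O(N^(-t)), which is summable.
  have hcauchy : CauchySeq fun n => ∫ x in (0 : ℝ)..(M.q α), φ x * F n x := by
    refine cauchySeq_of_summable_dist (Summable.of_norm_bounded_eventually_nat
      ((hM.summable t ht).mul_left B) ?_)
    filter_upwards [hB] with n hn
    rw [Real.norm_eq_abs, abs_of_nonneg dist_nonneg, dist_comm, Real.dist_eq,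
      ← intervalIntegral.integral_sub (hint _) (hint _)]
    simp only [← mul_sub]
    exact hn
  obtain ⟨l, hl⟩ := cauchySeq_tendsto_of_complete hcauchy
  refine ⟨l, hl.congr fun n => intervalIntegral.integral_congr_ae ?_⟩
  exact Eventually.of_forall (heq n)
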